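/- Let $\mathcal{O}_\beta$, for $\beta\in(0,\pi)$, be the set of the two lines through the origin with orientations $0$ and $\beta$ (directions $(1,0)$ and $(\cos\beta,\sin\beta)$). An $\mathcal{O}_\beta$-quadrant is a translate of one of the four open wedges that result from removing these two lines from the plane. The $\mathcal{O}_\beta$-convex hull $\mathcal{O}_\beta\mathcal{H}(P)$ of a finite set $P\subset\mathbb{R}^2$ is the complement of the union of all $\mathcal{O}_\beta$-quadrants that contain no point of $P$. **Theorem.** Let $R$ and $B$ be two disjoint finite sets of points in the plane such that $R\cup B$ contains no three points on a line and no two points on a horizontal line, and let $n=|R|+|B|$. (i) There is at most one open angular interval of $\beta\in(0,\pi)$ where $\mathcal{O}_\beta\mathcal{H}(B)$ is contained in $\mathcal{O}_\beta\mathcal{H}(R)$. Precisely: the set $S$ of all $\beta\in(0,\pi)$ such that $\mathcal{O}_\beta\mathcal{H}(B)$ is contained in the interior of $\mathcal{O}_\beta\mathcal{H}(R)$ is a (possibly empty) open interval. Moreover, the set of all $\beta\in(0,\pi)$ such that $\mathcal{O}_\beta\mathcal{H}(B)\subseteq\mathcal{O}_\beta\mathcal{H}(R)$ is a (possibly empty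 or degenerate) interval, whose interior is $S$. (ii) The interval $S$ can be computed in $O(n\log n)$ time and $O(n)$ space on the real RAM: there is one program which, given the coordinates of the points of $R$ and of $B$, each listed in an arbitrary order, reports whether $S$ is empty and, if it is not, the two endpoints of $S$, within these bounds. The real RAM has registers and memory cells for real numbers and for integers, the latter used as indices and bounded by $O(n)$. In one step it performs an arithmetic operation, a square root, a (direct or inverse) trigonometric function, a comparison, or an (indirectly addressed) memory access. -/

import Mathlib

/-! ## The `O_β`-convex hull -/

namespace OBeta

/-- The plane. (Only its affine structure and its topology are used.) -/
abbrev Plane : Type := ℝ × ℝ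

/-- `q` is an `O_β`-quadrant: for some vertex `x`, one of the four open wedges that are left when
the two lines through `x` with direction vectors `(1, 0)` and `(cos β, sin β)` are removed from
the plane. The signs `ε` and `δ` select the wedge. -/
def IsQuadrant (β : ℝ) (q : Set Plane) : Prop :=
  ∃ (x : Plane) (ε δ : ℝ), (ε = 1 ∨ ε = -1) ∧ (δ = 1 ∨ δ = -1) ∧
    q = {y | ∃ s t : ℝ, 0 < s ∧ 0 < t ∧
      y = x + (s * ε) • ((1, 0) : Plane) + (t * δ) • ((Real.cos β, Real.sin β) : Plane)}

/-- The `O_β`-convex hull of `P`: the plane minus all `P`-free `O_β`-quadrants. -/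
def hull (β : ℝ) (P : Set Plane) : Set Plane :=
  Set.univ \ ⋃₀ {q | IsQuadrant β q ∧ Disjoint q P}

/-- The angles `β ∈ (0, π)` at which the hull of `B` is strictly contained in the hull of `R`:
no point of it lies on the boundary of the hull of `R`. -/
def strictContainmentAngles (R B : Set Plane) : Set ℝ :=
  {β | β ∈ Set.Ioo 0 Real.pi ∧ hull β B ⊆ interior (hull β R)}

/-- The angles `β ∈ (0, π)` at which the hull of `B` is a subset of the hull of `R`. -/
def weakContainmentAngles (R B : Set Plane) : Set ℝ :=
  {β | β ∈ Set.Ioo 0 Real.pi ∧ hull β B ⊆ hull β R}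

/-- No three distinct points of `P` are on a line, no two distinct points of `P` are on a
horizontal line. -/
def GeneralPosition (P : Set Plane) : Prop :=
  (∀ p ∈ P, ∀ q ∈ P, ∀ r ∈ P, p ≠ q → q ≠ r → p ≠ r → ¬ Collinear ℝ {p, q, r}) ∧
  (∀ p ∈ P, ∀ q ∈ P, p ≠ q → p.2 ≠ q.2)

end OBeta

/-! ## The real RAM

Programs are structured programs over a fixed finite number of registers (those that the program
mentions) and two memory arrays with indirect addressing, one for natural numbers (indices) and
one for real numbers. Each instruction and each test takes one step. -/

namespace RealRAM

/-- Operations on indices. (`sub` is truncated at `0`, `div` rounds down.) -/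
inductive IdxOp
  | add | sub | mul | div

/-- Arithmetic operations on reals. -/
inductive RealOp
  | add | sub | mul | div

/-- Unary operations on reals. -/
inductive RealFun
  | sqrt | sin | cos | tan | arcsin | arccos | arctan

def IdxOp.eval : IdxOp → ℕ → ℕ → ℕ
  | .add, a, b => a + b
  | .sub, a, b => a - b
  | .mul, a, b => a * b
  | .div, a, b => a / b

noncomputable def RealOp.eval : RealOp → ℝ → ℝ → ℝ
  | .add, a, b => a + b
  | .sub, a, b => a - b
  | .mul, a, b => a * b
  | .div, a, b => a / b

noncomputable def RealFun.eval : RealFun → ℝ → ℝ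
  | .sqrt, a => Real.sqrt a
  | .sin, a => Real.sin a
  | .cos, a => Real.cos a
  | .tan, a => Real.tan a
  | .arcsin, a => Real.arcsin a
  | .arccos, a => Real.arccos a
  | .arctan, a => Real.arctan a

/-- A state: index registers, real registers, index memory, real memory. -/
structure State where
  ireg : ℕ → ℕ
  rreg : ℕ → ℝ
  imem : ℕ → ℕ
  rmem : ℕ → ℝ

/-- Instructions; `d`, `a`, `b` are numbers of registers. -/
inductive Instr
  /-- index register `d` := the constant `c` -/
  | iconst (d c : ℕ)
  /-- index register `d` := index register `a` -/
  | imove (d a : ℕ)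
  /-- index register `d` := index register `a` `op` index register `b` -/
  | iop (op : IdxOp) (d a b : ℕ)
  /-- index register `d` := index memory at the address in index register `a` -/
  | iload (d a : ℕ)
  /-- index memory at the address in index register `a` := index register `b` -/
  | istore (a b : ℕ)
  /-- real register `d` := the constant `c` -/
  | rconst (d : ℕ) (c : ℚ)
  /-- real register `d` := real register `a` -/
  | rmove (d a : ℕ)
  /-- real register `d` := real register `a` `op` real register `b` -/
  | rop (op : RealOp) (d a b : ℕ)
  /-- real register `d` := `f` (real register `a`) -/
  | rfun (f : RealFun) (d a : ℕ)
  /-- real register `d` := real memory at the address in index register `a` -/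
  | rload (d a : ℕ)
  /-- real memory at the address in index register `a` := real register `b` -/
  | rstore (a b : ℕ)

/-- The effect of an instruction. -/
noncomputable def Instr.exec (σ : State) : Instr → State
  | .iconst d c => { σ with ireg := Function.update σ.ireg d c }
  | .imove d a => { σ with ireg := Function.update σ.ireg d (σ.ireg a) }
  | .iop op d a b =>
      { σ with ireg := Function.update σ.ireg d (op.eval (σ.ireg a) (σ.ireg b)) }
  | .iload d a => { σ with ireg := Function.update σ.ireg d (σ.imem (σ.ireg a)) }
  | .istore a b => { σ with imem := Function.update σ.imem (σ.ireg a) (σ.ireg b) }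
  | .rconst d c => { σ with rreg := Function.update σ.rreg d (c : ℝ) }
  | .rmove d a => { σ with rreg := Function.update σ.rreg d (σ.rreg a) }
  | .rop op d a b =>
      { σ with rreg := Function.update σ.rreg d (op.eval (σ.rreg a) (σ.rreg b)) }
  | .rfun f d a => { σ with rreg := Function.update σ.rreg d (f.eval (σ.rreg a)) }
  | .rload d a => { σ with rreg := Function.update σ.rreg d (σ.rmem (σ.ireg a)) }
  | .rstore a b => { σ with rmem := Function.update σ.rmem (σ.ireg a) (σ.rreg b) }

/-- `i.Fits m σ`: on a machine of size `m`, the instruction `i` can be executed in state `σ`.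
Each memory array of such a machine has the `m` cells `0, …, m - 1`, and an index register holds a
number that is at most `m`. (An index memory cell only ever receives the content of a register.) -/
def Instr.Fits (m : ℕ) (σ : State) : Instr → Prop
  | .iconst _ c => c ≤ m
  | .imove _ _ => True
  | .iop op _ a b => op.eval (σ.ireg a) (σ.ireg b) ≤ m
  | .iload _ a => σ.ireg a < m
  | .istore a _ => σ.ireg a < m
  | .rconst _ _ => True
  | .rmove _ _ => True
  | .rop _ _ _ _ => True
  | .rfun _ _ _ => True
  | .rload _ a => σ.ireg a < m
  | .rstore a _ => σ.ireg a < m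

/-- Tests: comparisons of two index registers or of two real registers. -/
inductive Test
  | ile (a b : ℕ)
  | rle (a b : ℕ)

def Test.Holds (σ : State) : Test → Prop
  | .ile a b => σ.ireg a ≤ σ.ireg b
  | .rle a b => σ.rreg a ≤ σ.rreg b

/-- Programs: instructions, composition, if-then-else, while-loops. -/
inductive Prog
  | skip
  | instr (i : Instr)
  | seq (c₁ c₂ : Prog)
  | cond (b : Test) (c₁ c₂ : Prog)
  | loop (b : Test) (c : Prog)

/-- `Run m c σ t τ`: on a machine of size `m`, the program `c`, started in state `σ`, halts after
exactly `t` steps in state `τ`. -/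
inductive Run (m : ℕ) : Prog → State → ℕ → State → Prop
  | skip (σ : State) : Run m .skip σ 0 σ
  | instr (i : Instr) (σ : State) (h : i.Fits m σ) : Run m (.instr i) σ 1 (i.exec σ)
  | seq {c₁ c₂ : Prog} {σ σ' τ : State} {t₁ t₂ : ℕ}
      (h₁ : Run m c₁ σ t₁ σ') (h₂ : Run m c₂ σ' t₂ τ) : Run m (.seq c₁ c₂) σ (t₁ + t₂) τ
  | cond_true {b : Test} {c₁ c₂ : Prog} {σ τ : State} {t : ℕ}
      (hb : b.Holds σ) (h : Run m c₁ σ t τ) : Run m (.cond b c₁ c₂) σ (t + 1) τ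
  | cond_false {b : Test} {c₁ c₂ : Prog} {σ τ : State} {t : ℕ}
      (hb : ¬ b.Holds σ) (h : Run m c₂ σ t τ) : Run m (.cond b c₁ c₂) σ (t + 1) τ
  | loop_true {b : Test} {c : Prog} {σ σ' τ : State} {t₁ t₂ : ℕ}
      (hb : b.Holds σ) (h₁ : Run m c σ t₁ σ') (h₂ : Run m (.loop b c) σ' t₂ τ) :
      Run m (.loop b c) σ (t₁ + t₂ + 1) τ
  | loop_false {b : Test} {c : Prog} {σ : State} (hb : ¬ b.Holds σ) :
      Run m (.loop b c) σ 1 σ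

/-- The initial state for the red points `rs` and the blue points `bs`: index registers `0` and `1`
hold the numbers of red and of blue points, the real memory holds the two coordinates of each red
point and then those of each blue point; everything else is `0`. -/
noncomputable def input (rs bs : List OBeta.Plane) : State where
  ireg := fun k => if k = 0 then rs.length else if k = 1 then bs.length else 0
  rreg := fun _ => 0
  imem := fun _ => 0
  rmem := fun k =>
    if k % 2 = 0 then ((rs ++ bs).getD (k / 2) (0, 0)).1 else ((rs ++ bs).getD (k / 2) (0, 0)).2

/-- The state `τ` describes the set `S`: either index register `0` holds `0` and `S` is empty, or
it holds `1` and `S` is the nonempty open interval between the contents of the real registers `0`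
and `1`. -/
def Describes (τ : State) (S : Set ℝ) : Prop :=
  (τ.ireg 0 = 0 ∧ S = ∅) ∨
  (τ.ireg 0 = 1 ∧ τ.rreg 0 < τ.rreg 1 ∧ S = Set.Ioo (τ.rreg 0) (τ.rreg 1))

end RealRAM

/-! In the coordinates `tilt β` and `y` the four kinds of quadrants become the axis-parallel ones.
For a finite set, a point lies in the hull iff each closed quadrant at it meets the set, and in the
interior of the hull iff each open quadrant does. Lying in a quadrant of a given sign pair is a
transitive relation, so containment of hulls has to be tested only at the blue points: for every
sign pair `(ε, δ)`, the quadrant at each `b ∈ B` must contain a red point (`hull_subset_hull_iff`,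
`hull_subset_interior_hull_iff`).

Fix the signs. If `r` is on the `δ`-side of `b`, then `r` lies in the open quadrant at `b` iff the
angle `invSlope ε δ b r`, which does not depend on `β`, exceeds `ε δ (π / 2 - β)`
(`lt_invSlope_iff`). Over all `b` this becomes `ε δ (π / 2 - β) < T ε δ`, where `T ε δ` is a minimum
over `b` of maxima over `r`. The two sign pairs with product `1` bound `β` from below, the other two
from above; hence the open interval. Weak containment gives the same inequalities with `≤`, because
no red and blue point have the same height.

For the algorithm, one sweep per sign pair visits the points by decreasing `δ y` and keeps red
points as a convex chain on a stack. Only the running minimum `T` matters, so the stack needs to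
dominate the red points seen so far only in directions `c` with `arctan c ≤ T`. This allows a blue
point `z` to pop the chain just as a red one does: in each direction a popped point is dominated by
its successor or by `z`, and once `T` is lowered to the angle from `z` to the new top, that top
dominates `z` in all directions that are left (`PopInv.pop`, `Inv.lower_min`). No popped point ever
returns, so apart from finding the order the sweep is linear. A tournament tree yields the points in
order, with logarithmic cost per point. -/

namespace OBeta

open Filter Topology

/-! ### Hulls in the coordinates adapted to `β`. -/

/-- The linear form that vanishes on the direction `(cos β, sin β)`. -/
noncomputable def tilt (β : ℝ) (p : Plane) : ℝ := p.1 * Real.sin β - p.2 * Real.cos β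

/-- A sign is `1` or `-1`. -/
def IsSign (ε : ℝ) : Prop := ε = 1 ∨ ε = -1

theorem IsSign.mul_self {ε : ℝ} (h : IsSign ε) : ε * ε = 1 := by
  rcases h with rfl | rfl <;> norm_num

/-- The point with offsets `a`, `c` from `x` along the two directions of `β`. -/
noncomputable def shift (β : ℝ) (x : Plane) (a c : ℝ) : Plane :=
  x + a • ((1, 0) : Plane) + c • ((Real.cos β, Real.sin β) : Plane)

theorem tilt_shift (β : ℝ) (x : Plane) (a c : ℝ) :
    tilt β (shift β x a c) = tilt β x + a * Real.sin β := by
  simp [tilt, shift]; ring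

theorem shift_snd (β : ℝ) (x : Plane) (a c : ℝ) :
    (shift β x a c).2 = x.2 + c * Real.sin β := by
  simp [shift]

theorem eq_shift {β : ℝ} (hβ : 0 < Real.sin β) (x y : Plane) :
    y = shift β x ((tilt β y - tilt β x) / Real.sin β) ((y.2 - x.2) / Real.sin β) := by
  have := hβ.ne'
  ext
  · simp [shift, tilt]; field_simp; ring
  · simp [shift]; field_simp; ring

theorem mem_quadrant_iff {β : ℝ} (hβ : 0 < Real.sin β) {ε δ : ℝ} (hε : IsSign ε) (hδ : IsSign δ)
    (x y : Plane) :
    (∃ s t : ℝ, 0 < s ∧ 0 < t ∧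
      y = x + (s * ε) • ((1, 0) : Plane) + (t * δ) • ((Real.cos β, Real.sin β) : Plane)) ↔
    0 < ε * (tilt β y - tilt β x) ∧ 0 < δ * (y.2 - x.2) := by
  constructor
  · rintro ⟨s, t, hs, ht, h⟩
    have h1 := tilt_shift β x (s * ε) (t * δ)
    have h2 := shift_snd β x (s * ε) (t * δ)
    rw [shift, ← h] at h1 h2
    rw [h1, h2]
    have e1 : ε * (tilt β x + s * ε * Real.sin β - tilt β x) = (ε * ε) * (s * Real.sin β) := by ring
    have e2 : δ * (x.2 + t * δ * Real.sin β - x.2) = (δ * δ) * (t * Real.sin β) := by ring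
    rw [e1, e2, hε.mul_self, hδ.mul_self]
    constructor <;> positivity
  · rintro ⟨h1, h2⟩
    refine ⟨ε * (tilt β y - tilt β x) / Real.sin β, δ * (y.2 - x.2) / Real.sin β,
      by positivity, by positivity, ?_⟩
    have e1 : ε * (tilt β y - tilt β x) / Real.sin β * ε
        = (tilt β y - tilt β x) / Real.sin β := by
      linear_combination (tilt β y - tilt β x) / Real.sin β * hε.mul_self
    have e2 : δ * (y.2 - x.2) / Real.sin β * δ = (y.2 - x.2) / Real.sin β := by
      linear_combination (y.2 - x.2) / Real.sin β * hδ.mul_self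
    rw [e1, e2]
    exact eq_shift hβ x y

/-- A point is in the hull iff each closed quadrant at it meets `P`. -/
theorem mem_hull_iff {β : ℝ} (hβ : 0 < Real.sin β) {P : Set Plane} (hP : P.Finite) (x : Plane) :
    x ∈ hull β P ↔ ∀ ε δ : ℝ, IsSign ε → IsSign δ →
      ∃ p ∈ P, 0 ≤ ε * (tilt β p - tilt β x) ∧ 0 ≤ δ * (p.2 - x.2) := by
  constructor
  · intro hx ε δ hε hδ
    by_contra! hno
    -- Each of the finitely many points misses the closed quadrant by a positive gap. Moving the
    -- vertex back by a small `η` therefore gives an open quadrant that contains `x` and is still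
    -- free of `P`.
    have hev : ∀ᶠ η : ℝ in 𝓝[>] 0, ∀ p ∈ P,
        ε * (tilt β p - tilt β x) + η * Real.sin β ≤ 0 ∨ δ * (p.2 - x.2) + η * Real.sin β ≤ 0 := by
      rw [Filter.eventually_all_finite hP]
      intro p hp
      have key : ∀ c : ℝ, c < 0 → ∀ᶠ η : ℝ in 𝓝[>] 0, c + η * Real.sin β ≤ 0 := by
        intro c hc
        have : Tendsto (fun η : ℝ => c + η * Real.sin β) (𝓝[>] 0) (𝓝 c) := by
          have h0 : Tendsto (fun η : ℝ => c + η * Real.sin β) (𝓝 0) (𝓝 (c + 0 * Real.sin β)) :=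
            Continuous.tendsto (by fun_prop) 0
          rw [zero_mul, add_zero] at h0
          exact h0.mono_left nhdsWithin_le_nhds
        exact (this.eventually_lt_const hc).mono fun _ h => h.le
      rcases lt_or_ge (ε * (tilt β p - tilt β x)) 0 with h | h
      · exact (key _ h).mono fun _ => Or.inl
      · exact (key _ (hno p hp h)).mono fun _ => Or.inr
    obtain ⟨η, hη, hη0⟩ := (hev.and self_mem_nhdsWithin).exists
    have hη0 : 0 < η := hη0
    refine hx.2 (Set.mem_sUnion.2 ⟨_, ⟨⟨shift β x (-(η * ε)) (-(η * δ)), ε, δ, hε, hδ, rfl⟩, ?_⟩, ?_⟩)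
    · rw [Set.disjoint_left]
      intro p hpq hp
      rw [Set.mem_ofPred_eq, mem_quadrant_iff hβ hε hδ, tilt_shift, shift_snd] at hpq
      have e1 : ε * (tilt β p - (tilt β x + -(η * ε) * Real.sin β)) =
          ε * (tilt β p - tilt β x) + (ε * ε) * (η * Real.sin β) := by ring
      have e2 : δ * (p.2 - (x.2 + -(η * δ) * Real.sin β)) =
          δ * (p.2 - x.2) + (δ * δ) * (η * Real.sin β) := by ring
      rw [e1, e2, hε.mul_self, hδ.mul_self, one_mul] at hpq
      rcases hη p hp with h | h <;> linarith [hpq.1, hpq.2]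
    · rw [Set.mem_ofPred_eq, mem_quadrant_iff hβ hε hδ, tilt_shift, shift_snd]
      have e1 : ε * (tilt β x - (tilt β x + -(η * ε) * Real.sin β)) =
          (ε * ε) * (η * Real.sin β) := by ring
      have e2 : δ * (x.2 - (x.2 + -(η * δ) * Real.sin β)) = (δ * δ) * (η * Real.sin β) := by ring
      rw [e1, e2, hε.mul_self, hδ.mul_self]
      constructor <;> positivity
  · rintro h
    refine ⟨trivial, ?_⟩
    rintro ⟨_, ⟨⟨v, ε, δ, hε, hδ, rfl⟩, hd⟩, hxq⟩
    rw [Set.mem_ofPred_eq, mem_quadrant_iff hβ hε hδ] at hxq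
    obtain ⟨p, hp, h1, h2⟩ := h ε δ hε hδ
    refine Set.disjoint_left.1 hd ?_ hp
    rw [Set.mem_ofPred_eq, mem_quadrant_iff hβ hε hδ]
    constructor <;> nlinarith [hxq.1, hxq.2]

/-- A point is in the interior of the hull iff each open quadrant at it meets `P`. -/
theorem mem_interior_hull_iff {β : ℝ} (hβ : 0 < Real.sin β) {P : Set Plane} (hP : P.Finite)
    (x : Plane) :
    x ∈ interior (hull β P) ↔ ∀ ε δ : ℝ, IsSign ε → IsSign δ →
      ∃ p ∈ P, 0 < ε * (tilt β p - tilt β x) ∧ 0 < δ * (p.2 - x.2) := by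
  rw [mem_interior_iff_mem_nhds]
  constructor
  · intro hx ε δ hε hδ
    -- Move `x` slightly into the quadrant. The moved point is still in the hull, and the closed
    -- quadrant at it lies in the open quadrant at `x`.
    have hlim : Tendsto (fun η : ℝ => shift β x (η * ε) (η * δ)) (𝓝[>] 0) (𝓝 x) := by
      have h0 : Tendsto (fun η : ℝ => shift β x (η * ε) (η * δ)) (𝓝 0)
          (𝓝 (shift β x (0 * ε) (0 * δ))) :=
        Continuous.tendsto (by unfold shift; fun_prop) 0
      have e : shift β x (0 * ε) (0 * δ) = x := by simp [shift]
      rw [e] at h0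
      exact h0.mono_left nhdsWithin_le_nhds
    obtain ⟨η, hη, hη0⟩ := ((hlim.eventually hx).and self_mem_nhdsWithin).exists
    have hη0 : 0 < η := hη0
    obtain ⟨p, hp, h1, h2⟩ := (mem_hull_iff hβ hP _).1 hη ε δ hε hδ
    rw [tilt_shift] at h1
    rw [shift_snd] at h2
    have e1 : ε * (tilt β p - (tilt β x + η * ε * Real.sin β)) =
        ε * (tilt β p - tilt β x) - (ε * ε) * (η * Real.sin β) := by ring
    have e2 : δ * (p.2 - (x.2 + η * δ * Real.sin β)) =
        δ * (p.2 - x.2) - (δ * δ) * (η * Real.sin β) := by ring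
    rw [e1, hε.mul_self] at h1
    rw [e2, hδ.mul_self] at h2
    have : 0 < η * Real.sin β := by positivity
    exact ⟨p, hp, by linarith, by linarith⟩
  · intro h
    have key : ∀ ε δ : ℝ, IsSign ε → IsSign δ → ∀ᶠ x' in 𝓝 x,
        ∃ p ∈ P, 0 < ε * (tilt β p - tilt β x') ∧ 0 < δ * (p.2 - x'.2) := by
      intro ε δ hε hδ
      obtain ⟨p, hp, h1, h2⟩ := h ε δ hε hδ
      have c1 : Continuous fun x' : Plane => ε * (tilt β p - tilt β x') := by
        unfold tilt; fun_prop
      have c2 : Continuous fun x' : Plane => δ * (p.2 - x'.2) := by fun_prop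
      filter_upwards [(c1.tendsto x).eventually_const_lt h1, (c2.tendsto x).eventually_const_lt h2]
        with x' h1' h2' using ⟨p, hp, h1', h2'⟩
    filter_upwards [key 1 1 (.inl rfl) (.inl rfl), key 1 (-1) (.inl rfl) (.inr rfl),
      key (-1) 1 (.inr rfl) (.inl rfl), key (-1) (-1) (.inr rfl) (.inr rfl)] with x' k1 k2 k3 k4
    rw [mem_hull_iff hβ hP]
    intro ε δ hε hδ
    have : ∃ p ∈ P, 0 < ε * (tilt β p - tilt β x') ∧ 0 < δ * (p.2 - x'.2) := by
      rcases hε with rfl | rfl <;> rcases hδ with rfl | rfl <;> assumption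
    obtain ⟨p, hp, a, b⟩ := this
    exact ⟨p, hp, a.le, b.le⟩

theorem subset_hull {β : ℝ} (hβ : 0 < Real.sin β) {P : Set Plane} (hP : P.Finite) :
    P ⊆ hull β P := fun x hx =>
  (mem_hull_iff hβ hP x).2 fun _ _ _ _ => ⟨x, hx, by simp, by simp⟩

/-- By transitivity: a point of the blue hull sees some `b` in its quadrant, and `b` sees some `r`
in the quadrant of the same signs. So the blue points themselves are the only ones to test. -/
theorem hull_subset_hull_iff {β : ℝ} (hβ : 0 < Real.sin β) {R B : Set Plane} (hR : R.Finite)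
    (hB : B.Finite) :
    hull β B ⊆ hull β R ↔ ∀ ε δ : ℝ, IsSign ε → IsSign δ → ∀ b ∈ B,
      ∃ r ∈ R, 0 ≤ ε * (tilt β r - tilt β b) ∧ 0 ≤ δ * (r.2 - b.2) := by
  constructor
  · intro h ε δ hε hδ b hb
    exact (mem_hull_iff hβ hR b).1 (h (subset_hull hβ hB hb)) ε δ hε hδ
  · intro h x hx
    rw [mem_hull_iff hβ hR]
    intro ε δ hε hδ
    obtain ⟨b, hb, h1, h2⟩ := (mem_hull_iff hβ hB x).1 hx ε δ hε hδ
    obtain ⟨r, hr, h3, h4⟩ := h ε δ hε hδ b hb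
    exact ⟨r, hr, by nlinarith, by nlinarith⟩

theorem hull_subset_interior_hull_iff {β : ℝ} (hβ : 0 < Real.sin β) {R B : Set Plane}
    (hR : R.Finite) (hB : B.Finite) :
    hull β B ⊆ interior (hull β R) ↔ ∀ ε δ : ℝ, IsSign ε → IsSign δ → ∀ b ∈ B,
      ∃ r ∈ R, 0 < ε * (tilt β r - tilt β b) ∧ 0 < δ * (r.2 - b.2) := by
  constructor
  · intro h ε δ hε hδ b hb
    exact (mem_interior_hull_iff hβ hR b).1 (h (subset_hull hβ hB hb)) ε δ hε hδ
  · intro h x hx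
    rw [mem_interior_hull_iff hβ hR]
    intro ε δ hε hδ
    obtain ⟨b, hb, h1, h2⟩ := (mem_hull_iff hβ hB x).1 hx ε δ hε hδ
    obtain ⟨r, hr, h3, h4⟩ := h ε δ hε hδ b hb
    exact ⟨r, hr, by nlinarith, by nlinarith⟩

/-! ### Containment as inequalities between angles. -/

/-- The angle whose tangent is the inverse slope of the line from `b` to `r`, in the coordinates
`(ε x, δ y)`. -/
noncomputable def invSlope (ε δ : ℝ) (b r : Plane) : ℝ :=
  Real.arctan ((ε * r.1 - ε * b.1) / (δ * r.2 - δ * b.2))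

/-- `T` is the minimum over `b ∈ B` of the maximum of `invSlope ε δ b r` over the `r ∈ R` above `b`
(in the coordinates `(ε x, δ y)`), with `π / 2` for the empty minimum and `-π / 2` for the empty
maximum. -/
structure IsMinMax (R B : Set Plane) (ε δ T : ℝ) : Prop where
  ge : -(Real.pi / 2) ≤ T
  le : T ≤ Real.pi / 2
  lower : T = -(Real.pi / 2) ∨
    ∀ b ∈ B, ∃ r ∈ R, δ * b.2 < δ * r.2 ∧ T ≤ invSlope ε δ b r
  upper : T = Real.pi / 2 ∨
    ∃ b ∈ B, ∀ r ∈ R, δ * b.2 < δ * r.2 → invSlope ε δ b r ≤ T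

/-- Inserting `b` replaces `T` by its minimum with the maximal angle at `b`; if no red point is
above `b`, the value drops to the least one, `-π / 2`. -/
theorem exists_isMinMax (R B : Finset Plane) (ε δ : ℝ) :
    ∃ T, IsMinMax (R : Set Plane) (B : Set Plane) ε δ T := by
  induction B using Finset.induction_on with
  | empty =>
    exact ⟨Real.pi / 2, by linarith [Real.pi_pos], le_rfl, .inr (by simp), .inl rfl⟩
  | insert b B _ ih =>
    obtain ⟨T, h1, h2, h3, h4⟩ := ih
    by_cases hne : (R.filter fun r => δ * b.2 < δ * r.2).Nonempty
    · obtain ⟨r, hr, hmax⟩ := Finset.exists_max_image _ (invSlope ε δ b) hne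
      rw [Finset.mem_filter] at hr
      refine ⟨min T (invSlope ε δ b r), le_min h1 (Real.neg_pi_div_two_lt_arctan _).le,
        (min_le_left _ _).trans h2, ?_, ?_⟩
      · rcases h3 with rfl | h3
        · exact .inl (min_eq_left (Real.neg_pi_div_two_lt_arctan _).le)
        · right
          intro b' hb'
          rw [Finset.coe_insert] at hb'
          rcases hb' with rfl | hb'
          · exact ⟨r, hr.1, hr.2, min_le_right _ _⟩
          · obtain ⟨r', a, b, c⟩ := h3 b' hb'
            exact ⟨r', a, b, (min_le_left _ _).trans c⟩
      · by_cases hle : T ≤ invSlope ε δ b r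
        · rw [min_eq_left hle]
          refine h4.imp id ?_
          rintro ⟨b', hb', h⟩
          exact ⟨b', by simp_all, h⟩
        · rw [min_eq_right (not_le.1 hle).le]
          right
          refine ⟨b, by simp, fun r' hr' h => hmax r' ?_⟩
          simpa using ⟨hr', h⟩
    · rw [Finset.not_nonempty_iff_eq_empty, Finset.filter_eq_empty_iff] at hne
      exact ⟨-(Real.pi / 2), le_rfl, by linarith [Real.pi_pos], .inl rfl,
        .inr ⟨b, by simp, fun r hr h => absurd h (hne hr)⟩⟩

/-- The strict bounds on `t` make the default values harmless: `-π / 2` is never above `t`, and `π /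
2` always is. -/
theorem IsMinMax.lt_iff {R B : Set Plane} {ε δ T : ℝ} (h : IsMinMax R B ε δ T) {t : ℝ}
    (h1 : -(Real.pi / 2) < t) (h2 : t < Real.pi / 2) :
    t < T ↔ ∀ b ∈ B, ∃ r ∈ R, δ * b.2 < δ * r.2 ∧ t < invSlope ε δ b r := by
  constructor
  · intro ht b hb
    rcases h.lower with h3 | h3
    · linarith
    · obtain ⟨r, x, y, z⟩ := h3 b hb
      exact ⟨r, x, y, by linarith⟩
  · intro hall
    rcases h.upper with h3 | ⟨b, hb, h3⟩
    · linarith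
    · obtain ⟨r, x, y, z⟩ := hall b hb
      linarith [h3 r x y]

theorem IsMinMax.le_iff {R B : Set Plane} {ε δ T : ℝ} (h : IsMinMax R B ε δ T) {t : ℝ}
    (h1 : -(Real.pi / 2) < t) (h2 : t < Real.pi / 2) :
    t ≤ T ↔ ∀ b ∈ B, ∃ r ∈ R, δ * b.2 < δ * r.2 ∧ t ≤ invSlope ε δ b r := by
  constructor
  · intro ht b hb
    rcases h.lower with h3 | h3
    · linarith
    · obtain ⟨r, x, y, z⟩ := h3 b hb
      exact ⟨r, x, y, by linarith⟩
  · intro hall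
    rcases h.upper with h3 | ⟨b, hb, h3⟩
    · linarith
    · obtain ⟨r, x, y, z⟩ := hall b hb
      linarith [h3 r x y]

theorem sign_mul_lt_half_pi {ε δ β : ℝ} (hε : IsSign ε) (hδ : IsSign δ)
    (hβ : β ∈ Set.Ioo 0 Real.pi) :
    -(Real.pi / 2) < ε * δ * (Real.pi / 2 - β) ∧ ε * δ * (Real.pi / 2 - β) < Real.pi / 2 := by
  obtain ⟨h1, h2⟩ := hβ
  rcases hε with rfl | rfl <;> rcases hδ with rfl | rfl <;> constructor <;> linarith

theorem tan_sign_mul {ε δ β : ℝ} (hε : IsSign ε) (hδ : IsSign δ) :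
    Real.tan (ε * δ * (Real.pi / 2 - β)) = ε * δ * (Real.cos β / Real.sin β) := by
  have h : Real.tan (Real.pi / 2 - β) = Real.cos β / Real.sin β := by
    rw [Real.tan_eq_sin_div_cos, Real.sin_pi_div_two_sub, Real.cos_pi_div_two_sub]
  have h' : Real.tan (-(Real.pi / 2 - β)) = -(Real.cos β / Real.sin β) := by
    rw [Real.tan_neg, h]
  rcases hε with rfl | rfl <;> rcases hδ with rfl | rfl <;>
    simp only [one_mul, mul_one, mul_neg, neg_mul, neg_neg, h, h']

/-- The left side has tangent `ε δ cot β`. Comparing tangents and clearing the positive factors `sin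
β` and `δ (r.2 - b.2)` turns the inequality into the sign condition on `tilt`. -/
theorem lt_invSlope_iff {ε δ β : ℝ} (hε : IsSign ε) (hδ : IsSign δ) (hβ : β ∈ Set.Ioo 0 Real.pi)
    {b r : Plane} (h : δ * b.2 < δ * r.2) :
    ε * δ * (Real.pi / 2 - β) < invSlope ε δ b r ↔ 0 < ε * (tilt β r - tilt β b) := by
  have hs := Real.sin_pos_of_mem_Ioo hβ
  obtain ⟨h1, h2⟩ := sign_mul_lt_half_pi hε hδ hβ
  have hd : 0 < δ * r.2 - δ * b.2 := by linarith
  rw [invSlope, ← Real.arctan_tan h1 h2, Real.arctan_strictMono.lt_iff_lt, tan_sign_mul hε hδ, lt_div_iff₀ hd,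
    ← sub_pos, ← mul_pos_iff_of_pos_left hs]
  have e : Real.sin β * (ε * r.1 - ε * b.1 -
      ε * δ * (Real.cos β / Real.sin β) * (δ * r.2 - δ * b.2)) = ε * (tilt β r - tilt β b) := by
    unfold tilt
    field_simp
    linear_combination -(Real.cos β * (r.2 - b.2)) * hδ.mul_self * ε
  rw [e]

theorem le_invSlope_iff {ε δ β : ℝ} (hε : IsSign ε) (hδ : IsSign δ) (hβ : β ∈ Set.Ioo 0 Real.pi)
    {b r : Plane} (h : δ * b.2 < δ * r.2) :
    ε * δ * (Real.pi / 2 - β) ≤ invSlope ε δ b r ↔ 0 ≤ ε * (tilt β r - tilt β b) := by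
  have hs := Real.sin_pos_of_mem_Ioo hβ
  obtain ⟨h1, h2⟩ := sign_mul_lt_half_pi hε hδ hβ
  have hd : 0 < δ * r.2 - δ * b.2 := by linarith
  rw [invSlope, ← Real.arctan_tan h1 h2, Real.arctan_strictMono.le_iff_le, tan_sign_mul hε hδ, le_div_iff₀ hd,
    ← sub_nonneg, ← mul_nonneg_iff_of_pos_left hs]
  have e : Real.sin β * (ε * r.1 - ε * b.1 -
      ε * δ * (Real.cos β / Real.sin β) * (δ * r.2 - δ * b.2)) = ε * (tilt β r - tilt β b) := by
    unfold tilt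
    field_simp
    linear_combination -(Real.cos β * (r.2 - b.2)) * hδ.mul_self * ε
  rw [e]

/-! ### The containment angles form intervals. -/

theorem mem_strictContainmentAngles_iff {R B : Finset Plane} {T : ℝ → ℝ → ℝ}
    (hT : ∀ ε δ, IsSign ε → IsSign δ → IsMinMax (R : Set Plane) (B : Set Plane) ε δ (T ε δ))
    {β : ℝ} (hβ : β ∈ Set.Ioo 0 Real.pi) :
    β ∈ strictContainmentAngles (R : Set Plane) (B : Set Plane) ↔
      ∀ ε δ, IsSign ε → IsSign δ → ε * δ * (Real.pi / 2 - β) < T ε δ := by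
  rw [strictContainmentAngles, Set.mem_ofPred_eq, and_iff_right hβ,
    hull_subset_interior_hull_iff (Real.sin_pos_of_mem_Ioo hβ) R.finite_toSet B.finite_toSet]
  refine forall₄_congr fun ε δ hε hδ => ?_
  rw [(hT ε δ hε hδ).lt_iff (sign_mul_lt_half_pi hε hδ hβ).1 (sign_mul_lt_half_pi hε hδ hβ).2]
  refine forall₂_congr fun b _ => exists_congr fun r => and_congr_right fun _ => ?_
  rw [and_comm, mul_sub δ, sub_pos]
  exact and_congr_right fun h => (lt_invSlope_iff hε hδ hβ h).symm

theorem mem_weakContainmentAngles_iff {R B : Finset Plane} (hd : Disjoint R B)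
    (hgp : GeneralPosition ((R : Set Plane) ∪ (B : Set Plane))) {T : ℝ → ℝ → ℝ}
    (hT : ∀ ε δ, IsSign ε → IsSign δ → IsMinMax (R : Set Plane) (B : Set Plane) ε δ (T ε δ))
    {β : ℝ} (hβ : β ∈ Set.Ioo 0 Real.pi) :
    β ∈ weakContainmentAngles (R : Set Plane) (B : Set Plane) ↔
      ∀ ε δ, IsSign ε → IsSign δ → ε * δ * (Real.pi / 2 - β) ≤ T ε δ := by
  rw [weakContainmentAngles, Set.mem_ofPred_eq, and_iff_right hβ,
    hull_subset_hull_iff (Real.sin_pos_of_mem_Ioo hβ) R.finite_toSet B.finite_toSet]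
  refine forall₄_congr fun ε δ hε hδ => ?_
  rw [(hT ε δ hε hδ).le_iff (sign_mul_lt_half_pi hε hδ hβ).1 (sign_mul_lt_half_pi hε hδ hβ).2]
  refine forall₂_congr fun b hb => exists_congr fun r => and_congr_right fun hr => ?_
  -- The closed quadrant allows equal heights, while `IsMinMax` asks for strictly larger ones.
  -- General position and disjointness close this gap.
  have hne : r.2 ≠ b.2 := hgp.2 r (.inl hr) b (.inr hb) fun h =>
    Finset.disjoint_left.1 hd hr (h ▸ hb)
  have hne' : δ * b.2 ≠ δ * r.2 := by
    rcases hδ with rfl | rfl <;> simpa using hne.symm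
  rw [and_comm, mul_sub δ, sub_nonneg, le_iff_lt_or_eq, or_iff_left hne']
  exact and_congr_right fun h => (le_invSlope_iff hε hδ hβ h).symm

theorem forall_isSign_iff {p : ℝ → ℝ → Prop} :
    (∀ ε δ, IsSign ε → IsSign δ → p ε δ) ↔ (p 1 1 ∧ p (-1) (-1)) ∧ p (-1) 1 ∧ p 1 (-1) := by
  constructor
  · intro h
    exact ⟨⟨h _ _ (.inl rfl) (.inl rfl), h _ _ (.inr rfl) (.inr rfl)⟩,
      h _ _ (.inr rfl) (.inl rfl), h _ _ (.inl rfl) (.inr rfl)⟩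
  · rintro ⟨⟨h1, h2⟩, h3, h4⟩ ε δ (rfl | rfl) (rfl | rfl) <;> assumption

theorem strictContainmentAngles_eq_Ioo {R B : Finset Plane} {T : ℝ → ℝ → ℝ}
    (hT : ∀ ε δ, IsSign ε → IsSign δ → IsMinMax (R : Set Plane) (B : Set Plane) ε δ (T ε δ)) :
    strictContainmentAngles (R : Set Plane) (B : Set Plane) =
      Set.Ioo (Real.pi / 2 - min (T 1 1) (T (-1) (-1)))
        (Real.pi / 2 + min (T (-1) 1) (T 1 (-1))) := by
  have l1 := (hT 1 1 (.inl rfl) (.inl rfl)).le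
  have l2 := (hT (-1) 1 (.inr rfl) (.inl rfl)).le
  have m1 := min_le_left (T 1 1) (T (-1) (-1))
  have m2 := min_le_left (T (-1) 1) (T 1 (-1))
  ext β
  constructor
  · intro h
    have h' := (mem_strictContainmentAngles_iff hT h.1).1 h
    rw [forall_isSign_iff] at h'
    obtain ⟨⟨h1, h2⟩, h3, h4⟩ := h'
    norm_num at h1 h2 h3 h4
    have a1 : Real.pi / 2 - β < min (T 1 1) (T (-1) (-1)) := lt_min (by linarith) (by linarith)
    have a2 : β - Real.pi / 2 < min (T (-1) 1) (T 1 (-1)) := lt_min (by linarith) (by linarith)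
    exact ⟨by linarith, by linarith⟩
  · rintro ⟨h1, h2⟩
    -- Every `T ε δ` is at most `π / 2`, which places `β` in `(0, π)`.
    rw [mem_strictContainmentAngles_iff hT ⟨by linarith, by linarith⟩, forall_isSign_iff]
    have m3 := min_le_right (T 1 1) (T (-1) (-1))
    have m4 := min_le_right (T (-1) 1) (T 1 (-1))
    refine ⟨⟨?_, ?_⟩, ?_, ?_⟩ <;> linarith

/-- The intersection with `(0, π)` is needed because the closed interval may contain `0` or `π`,
when a threshold is `π / 2`. -/
theorem weakContainmentAngles_eq_inter {R B : Finset Plane} (hd : Disjoint R B)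
    (hgp : GeneralPosition ((R : Set Plane) ∪ (B : Set Plane))) {T : ℝ → ℝ → ℝ}
    (hT : ∀ ε δ, IsSign ε → IsSign δ → IsMinMax (R : Set Plane) (B : Set Plane) ε δ (T ε δ)) :
    weakContainmentAngles (R : Set Plane) (B : Set Plane) =
      Set.Icc (Real.pi / 2 - min (T 1 1) (T (-1) (-1)))
        (Real.pi / 2 + min (T (-1) 1) (T 1 (-1))) ∩ Set.Ioo 0 Real.pi := by
  have m1 := min_le_left (T 1 1) (T (-1) (-1))
  have m2 := min_le_left (T (-1) 1) (T 1 (-1))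
  ext β
  constructor
  · intro h
    have h' := (mem_weakContainmentAngles_iff hd hgp hT h.1).1 h
    rw [forall_isSign_iff] at h'
    obtain ⟨⟨h1, h2⟩, h3, h4⟩ := h'
    norm_num at h1 h2 h3 h4
    have a1 : Real.pi / 2 - β ≤ min (T 1 1) (T (-1) (-1)) := le_min (by linarith) (by linarith)
    have a2 : β - Real.pi / 2 ≤ min (T (-1) 1) (T 1 (-1)) := le_min (by linarith) (by linarith)
    exact ⟨⟨by linarith, by linarith⟩, h.1⟩
  · rintro ⟨⟨h1, h2⟩, hβ⟩
    rw [mem_weakContainmentAngles_iff hd hgp hT hβ, forall_isSign_iff]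
    have m3 := min_le_right (T 1 1) (T (-1) (-1))
    have m4 := min_le_right (T (-1) 1) (T 1 (-1))
    refine ⟨⟨?_, ?_⟩, ?_, ?_⟩ <;> linarith

/-- The angles of strict containment form an open interval; those of weak containment form an
interval with the same interior. -/
theorem containmentAngles_intervals {R B : Finset Plane} (hd : Disjoint R B)
    (hgp : GeneralPosition ((R : Set Plane) ∪ (B : Set Plane))) :
    ∃ β₁ β₂ : ℝ,
      strictContainmentAngles (R : Set Plane) (B : Set Plane) = Set.Ioo β₁ β₂ ∧
      (weakContainmentAngles (R : Set Plane) (B : Set Plane)).OrdConnected ∧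
      interior (weakContainmentAngles (R : Set Plane) (B : Set Plane)) = Set.Ioo β₁ β₂ := by
  choose T hT using exists_isMinMax R B
  have hT' : ∀ ε δ, IsSign ε → IsSign δ → IsMinMax (R : Set Plane) (B : Set Plane) ε δ (T ε δ) :=
    fun ε δ _ _ => hT ε δ
  refine ⟨_, _, strictContainmentAngles_eq_Ioo hT', ?_, ?_⟩
  · rw [weakContainmentAngles_eq_inter hd hgp hT']
    exact Set.OrdConnected.inter Set.ordConnected_Icc Set.ordConnected_Ioo
  · rw [weakContainmentAngles_eq_inter hd hgp hT', interior_inter, interior_Icc, interior_Ioo,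
      Set.inter_eq_left, ← strictContainmentAngles_eq_Ioo hT']
    exact fun β hβ => hβ.1

end OBeta

/-! ### The sweep as an abstract stack algorithm. -/

namespace Sweep

/-- The inverse slope of the line through the points `z` and `p`. -/
noncomputable def slope (x y : ℕ → ℝ) (z p : ℕ) : ℝ := (x p - x z) / (y p - y z)

/-- The list (lowest point first) is a convex chain. -/
def IsConvexChain (x y : ℕ → ℝ) : List ℕ → Prop
  | [] => True
  | p :: l => (∀ q ∈ l.head?, y p < y q ∧ ∀ s ∈ l.tail.head?, slope x y q s ≤ slope x y p q) ∧
      IsConvexChain x y l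

variable {x y : ℕ → ℝ}

/-- Seen from below, the lowest point of a convex chain is extreme if it beats the next one. -/
theorem IsConvexChain.slope_le {l : List ℕ} :
    ∀ {p z : ℕ}, IsConvexChain x y (p :: l) → y z < y p →
      (∀ q ∈ l.head?, slope x y p q ≤ slope x y z p) →
      ∀ s ∈ p :: l, slope x y z s ≤ slope x y z p := by
  induction l with
  | nil =>
    intro p z _ _ _ s hs
    rw [List.mem_singleton.1 hs]
  | cons q l ih =>
    intro p z hc hz hq s hs
    obtain ⟨hpq, hnext⟩ := hc.1 q rfl
    have hle : slope x y p q ≤ slope x y z p := hq q rfl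
    have h1 : 0 < y p - y z := by linarith
    have h2 : 0 < y q - y p := by linarith
    have h3 : 0 < y q - y z := by linarith
    have e1 : slope x y z p * (y p - y z) = x p - x z := div_mul_cancel₀ _ h1.ne'
    have e2 : slope x y p q * (y q - y p) = x q - x p := div_mul_cancel₀ _ h2.ne'
    -- The inverse slope from `z` to `q` is a weighted mean of those from `z` to `p` and from `p` to
    -- `q`, so it lies between them. The upper bound serves `q` itself, the lower one the induction
    -- with `q` as the lowest point.
    have le1 : slope x y z q ≤ slope x y z p := by
      rw [slope, div_le_iff₀ h3]
      nlinarith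
    have le2 : slope x y p q ≤ slope x y z q := by
      rw [slope.eq_1 x y z q, le_div_iff₀ h3]
      nlinarith
    rcases List.mem_cons.1 hs with rfl | hs
    · exact le_rfl
    · exact (ih hc.2 (hz.trans hpq) (fun s' hs' => (hnext s' hs').trans le2) s hs).trans le1

/-- In every direction up to the angle `T`, each red point of `D` is dominated by a point of the
stack or by one satisfying `E`. -/
def Dominates (x y : ℕ → ℝ) (D : Finset ℕ) (red : ℕ → Prop) (stack : List ℕ) (E : ℕ → Prop)
    (T : ℝ) : Prop :=
  ∀ c, Real.arctan c ≤ T → ∀ r ∈ D, red r →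
    ∃ s, (s ∈ stack ∨ E s) ∧ x r - c * y r ≤ x s - c * y s

/-- The invariant of the sweep. -/
structure Inv (x y : ℕ → ℝ) (D : Finset ℕ) (red : ℕ → Prop) (T₀ : ℝ) (stack : List ℕ) (T : ℝ) :
    Prop where
  mem : ∀ s ∈ stack, s ∈ D ∧ red s
  chain : IsConvexChain x y stack
  ge : -(Real.pi / 2) ≤ T
  le : T ≤ T₀
  dom : Dominates x y D red stack (fun _ => False) T
  lower : T = -(Real.pi / 2) ∨
    ∀ b ∈ D, ¬ red b → ∃ r ∈ D, red r ∧ y b < y r ∧ T ≤ Real.arctan (slope x y b r)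
  upper : T = T₀ ∨
    ∃ b ∈ D, ¬ red b ∧ ∀ r ∈ D, red r → y b < y r → Real.arctan (slope x y b r) ≤ T

/-- The part of the invariant that holds while points are popped for the sake of `z`. -/
structure PopInv (x y : ℕ → ℝ) (D : Finset ℕ) (red : ℕ → Prop) (z : ℕ) (T : ℝ)
    (stack : List ℕ) : Prop where
  mem : ∀ s ∈ stack, s ∈ D ∧ red s
  chain : IsConvexChain x y stack
  dom : Dominates x y D red stack (fun s => s = z) T

variable {D : Finset ℕ} {red : ℕ → Prop} {T₀ T : ℝ} {stack : List ℕ} {z : ℕ}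

theorem Inv.initial (h : -(Real.pi / 2) ≤ T₀) : Inv x y ∅ red T₀ [] T₀ where
  mem := by simp
  chain := trivial
  ge := h
  le := le_rfl
  dom := by simp [Dominates]
  lower := .inr (by simp)
  upper := .inl rfl

theorem Inv.popInv (h : Inv x y D red T₀ stack T) : PopInv x y D red z T stack :=
  ⟨h.mem, h.chain, fun c hc r hr hred => by
    obtain ⟨s, hs, hle⟩ := h.dom c hc r hr hred
    exact ⟨s, hs.imp id False.elim, hle⟩⟩

/-- In directions up to the slope from `p` to `q`, the point `q` dominates `p`. In steeper ones `z`
does, since the slope from `z` to `p` is no larger. This does not depend on the colour of `z`. -/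
theorem PopInv.pop {p q : ℕ} {l : List ℕ} (h : PopInv x y D red z T (p :: q :: l))
    (hz : ∀ r ∈ D, y z < y r) (hpop : slope x y z p ≤ slope x y p q) :
    PopInv x y D red z T (q :: l) := by
  refine ⟨fun s hs => h.mem s (List.mem_cons_of_mem _ hs), h.chain.2, fun c hc r hr hred => ?_⟩
  obtain ⟨s, hs, hle⟩ := h.dom c hc r hr hred
  rw [List.mem_cons] at hs
  rcases hs with (rfl | hs) | hs
  · have h1 : 0 < y s - y z := sub_pos.2 (hz s (h.mem s (by simp)).1)
    have h2 : 0 < y q - y s := sub_pos.2 (h.chain.1 q rfl).1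
    rcases le_total c (slope x y s q) with hcq | hcq
    · rw [slope, le_div_iff₀ h2] at hcq
      exact ⟨q, .inl (by simp), by nlinarith⟩
    · have := hpop.trans hcq
      rw [slope, div_le_iff₀ h1] at this
      exact ⟨z, .inr rfl, by nlinarith⟩
  · exact ⟨s, .inl hs, hle⟩
  · exact ⟨s, .inr hs, hle⟩

/-- No further point has to be popped for the sake of `z`. -/
def Settled (x y : ℕ → ℝ) (z : ℕ) (stack : List ℕ) : Prop :=
  ∀ p ∈ stack.head?, ∀ q ∈ stack.tail.head?, slope x y p q ≤ slope x y z p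

theorem Inv.push (h : Inv x y D red T₀ stack T) (hz : ∀ r ∈ D, y z < y r) (hred : red z)
    {stack' : List ℕ} (hp : PopInv x y D red z T stack') (hs : Settled x y z stack') :
    Inv x y (insert z D) red T₀ (z :: stack') T where
  mem := by
    intro s hs
    rcases List.mem_cons.1 hs with rfl | hs
    · exact ⟨Finset.mem_insert_self _ _, hred⟩
    · exact ⟨Finset.mem_insert_of_mem (hp.mem s hs).1, (hp.mem s hs).2⟩
  chain := by
    refine ⟨fun q hq => ⟨hz q ?_, fun s hs' => hs q hq s hs'⟩, hp.chain⟩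
    exact (hp.mem q (List.mem_of_mem_head? hq)).1
  ge := h.ge
  le := h.le
  dom := by
    intro c hc r hr hr'
    rcases Finset.mem_insert.1 hr with rfl | hr
    · exact ⟨r, .inl (by simp), le_rfl⟩
    · obtain ⟨s, hs, hle⟩ := hp.dom c hc r hr hr'
      refine ⟨s, .inl ?_, hle⟩
      rcases hs with hs | rfl
      · exact List.mem_cons_of_mem _ hs
      · simp
  lower := by
    refine h.lower.imp id fun h' b hb hbr => ?_
    rcases Finset.mem_insert.1 hb with rfl | hb
    · exact absurd hred hbr
    · obtain ⟨r, hr, h1⟩ := h' b hb hbr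
      exact ⟨r, Finset.mem_insert_of_mem hr, h1⟩
  upper := by
    refine h.upper.imp id ?_
    rintro ⟨b, hb, hbr, h'⟩
    refine ⟨b, Finset.mem_insert_of_mem hb, hbr, fun r hr hrr hlt => ?_⟩
    rcases Finset.mem_insert.1 hr with rfl | hr
    · exact absurd hlt (hz b hb).not_gt
    · exact h' r hr hrr hlt

/-- With an empty stack, only `z` can dominate the red points above it. This is impossible in
sufficiently small directions, so either there are no such points or no directions are left; in both
cases `-π / 2` is the right value. -/
theorem Inv.fail (h : Inv x y D red T₀ stack T) (hz : ∀ r ∈ D, y z < y r) (hred : ¬ red z)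
    (hp : PopInv x y D red z T []) :
    Inv x y (insert z D) red T₀ [] (-(Real.pi / 2)) where
  mem := by simp
  chain := trivial
  ge := le_rfl
  le := h.ge.trans h.le
  dom := fun c hc => absurd (Real.neg_pi_div_two_lt_arctan c) hc.not_gt
  lower := .inl rfl
  upper := by
    rcases h.ge.eq_or_lt with hT | hT
    · rcases h.upper with hu | ⟨b, hb, hbr, h'⟩
      · exact .inl (hT.trans hu)
      · refine .inr ⟨b, Finset.mem_insert_of_mem hb, hbr, fun r hr hrr hlt => ?_⟩
        rcases Finset.mem_insert.1 hr with rfl | hr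
        · exact absurd hrr hred
        · rw [hT]
          exact h' r hr hrr hlt
    · refine .inr ⟨z, Finset.mem_insert_self _ _, hred, fun r hr hrr hlt => ?_⟩
      exfalso
      have hrD : r ∈ D := (Finset.mem_insert.1 hr).resolve_left fun e => hred (e ▸ hrr)
      -- `tan t` is a direction still covered by `T`. Its minimum with a number below the slope from
      -- `z` to `r` is a covered direction in which `z` does not dominate `r`.
      obtain ⟨t, ht1, ht2⟩ := exists_between (lt_min hT (neg_lt_self Real.pi_div_two_pos))
      have hat := Real.arctan_tan ht1 (ht2.trans_le (min_le_right _ _))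
      have hzr := sub_pos.2 (hz r hrD)
      set c := min (Real.tan t) (slope x y z r - 1) with hc
      have hcT : Real.arctan c ≤ T := by
        refine (Real.arctan_strictMono.monotone (min_le_left _ _)).trans ?_
        rw [hat]
        exact (ht2.trans_le (min_le_left _ _)).le
      obtain ⟨s, hs, hle⟩ := hp.dom c hcT r hrD hrr
      rcases hs with hs | rfl
      · simp at hs
      · have hcl : c < slope x y s r := (min_le_right _ _).trans_lt (by linarith)
        rw [slope, lt_div_iff₀ hzr] at hcl
        linarith

/-- Because the chain is settled, its lowest point `p` attains the maximal slope from `z`. In the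
directions up to the new threshold `p` dominates `z`, so `z` is no longer needed as a dominating
point. -/
theorem Inv.lower_min (h : Inv x y D red T₀ stack T) (hz : ∀ r ∈ D, y z < y r) (hred : ¬ red z)
    {p : ℕ} {l : List ℕ} (hp : PopInv x y D red z T (p :: l)) (hs : Settled x y z (p :: l)) :
    Inv x y (insert z D) red T₀ (p :: l) (min T (Real.arctan (slope x y z p))) where
  mem := fun s hs => ⟨Finset.mem_insert_of_mem (hp.mem s hs).1, (hp.mem s hs).2⟩
  chain := hp.chain
  ge := le_min h.ge (Real.neg_pi_div_two_lt_arctan _).le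
  le := (min_le_left _ _).trans h.le
  dom := by
    intro c hc r hr hrr
    have hrD : r ∈ D := (Finset.mem_insert.1 hr).resolve_left fun e => hred (e ▸ hrr)
    obtain ⟨s, hs, hle⟩ := hp.dom c (hc.trans (min_le_left _ _)) r hrD hrr
    rcases hs with hs | rfl
    · exact ⟨s, .inl hs, hle⟩
    · refine ⟨p, .inl (by simp), hle.trans ?_⟩
      have hcp := Real.arctan_strictMono.le_iff_le.1 (hc.trans (min_le_right _ _))
      rw [slope, le_div_iff₀ (sub_pos.2 (hz p (hp.mem p (by simp)).1))] at hcp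
      linarith
  lower := by
    rcases h.lower with hl | hl
    · exact .inl (by rw [hl]; exact min_eq_left (Real.neg_pi_div_two_lt_arctan _).le)
    · refine .inr fun b hb hbr => ?_
      rcases Finset.mem_insert.1 hb with rfl | hb
      · obtain ⟨h1, h2⟩ := hp.mem p (by simp)
        exact ⟨p, Finset.mem_insert_of_mem h1, h2, hz p h1, min_le_right _ _⟩
      · obtain ⟨r, hr, h1, h2, h3⟩ := hl b hb hbr
        exact ⟨r, Finset.mem_insert_of_mem hr, h1, h2, (min_le_left _ _).trans h3⟩
  upper := by
    rcases le_or_gt T (Real.arctan (slope x y z p)) with hT | hT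
    · rw [min_eq_left hT]
      refine h.upper.imp id ?_
      rintro ⟨b, hb, hbr, h'⟩
      refine ⟨b, Finset.mem_insert_of_mem hb, hbr, fun r hr hrr => ?_⟩
      exact h' r ((Finset.mem_insert.1 hr).resolve_left fun e => hred (e ▸ hrr)) hrr
    · rw [min_eq_right hT.le]
      refine .inr ⟨z, Finset.mem_insert_self _ _, hred, fun r hr hrr _ => ?_⟩
      have hrD : r ∈ D := (Finset.mem_insert.1 hr).resolve_left fun e => hred (e ▸ hrr)
      by_contra! hlt
      -- In the direction `tan t`, the red `r` is strictly ahead of `z`, but all stack points are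
      -- strictly behind `z`. Hence nothing dominates `r`.
      obtain ⟨t, ht1, ht2⟩ := exists_between (lt_min hT hlt)
      have hat : Real.arctan (Real.tan t) = t :=
        Real.arctan_tan ((Real.neg_pi_div_two_lt_arctan _).trans ht1)
          ((ht2.trans_le (min_le_right _ _)).trans (Real.arctan_lt_pi_div_two _))
      obtain ⟨s, hs', hle⟩ := hp.dom (Real.tan t)
        (by rw [hat]; exact (ht2.trans_le (min_le_left _ _)).le) r hrD hrr
      have h1 : Real.tan t < slope x y z r :=
        Real.arctan_strictMono.lt_iff_lt.1 (by rw [hat]; exact ht2.trans_le (min_le_right _ _))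
      rw [slope, lt_div_iff₀ (sub_pos.2 (hz r hrD))] at h1
      rcases hs' with hs' | rfl
      · have h2 : slope x y z s ≤ slope x y z p :=
          hp.chain.slope_le (hz p (hp.mem p (by simp)).1) (hs p rfl) s hs'
        have h3 : slope x y z p < Real.tan t :=
          Real.arctan_strictMono.lt_iff_lt.1 (by rw [hat]; exact ht1)
        have h4 := h2.trans_lt h3
        rw [slope, div_lt_iff₀ (sub_pos.2 (hz s (hp.mem s hs').1))] at h4
        linarith
      · linarith

end Sweep

/-! ### Reasoning about runs and running times of programs. -/

namespace RealRAM

/-- On a machine of size `m`, the program `c`, started in `σ`, halts, after some number of steps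
and in some state that satisfy `Q`. -/
def Reaches (m : ℕ) (c : Prog) (σ : State) (Q : ℕ → State → Prop) : Prop :=
  ∃ t τ, Run m c σ t τ ∧ Q t τ

/-- Straight-line programs. -/
def block : List Instr → Prog
  | [] => .skip
  | i :: l => .seq (.instr i) (block l)

/-- The effect of a straight-line program. -/
noncomputable def execs : List Instr → State → State
  | [], σ => σ
  | i :: l, σ => execs l (i.exec σ)

/-- The straight-line program can be executed on a machine of size `m`. -/
def FitsAll (m : ℕ) : List Instr → State → Prop
  | [], _ => True
  | i :: l, σ => i.Fits m σ ∧ FitsAll m l (i.exec σ)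

variable {m : ℕ} {c c₁ c₂ : Prog} {σ : State} {Q Q' : ℕ → State → Prop} {b : Test}

theorem run_block {l : List Instr} (h : FitsAll m l σ) :
    Run m (block l) σ l.length (execs l σ) := by
  induction l generalizing σ with
  | nil => exact Run.skip σ
  | cons i l ih =>
    rw [List.length_cons, add_comm]
    exact Run.seq (Run.instr i σ h.1) (ih h.2)

theorem Reaches.mono (h : Reaches m c σ Q) (hQ : ∀ t τ, Q t τ → Q' t τ) : Reaches m c σ Q' := by
  obtain ⟨t, τ, h1, h2⟩ := h
  exact ⟨t, τ, h1, hQ t τ h2⟩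

theorem Reaches.block {l : List Instr} (h : FitsAll m l σ) (hQ : Q l.length (execs l σ)) :
    Reaches m (block l) σ Q := ⟨_, _, run_block h, hQ⟩

theorem Reaches.skip (h : Q 0 σ) : Reaches m .skip σ Q := ⟨_, _, Run.skip σ, h⟩

theorem Reaches.seq (h : Reaches m c₁ σ fun t₁ σ' => Reaches m c₂ σ' fun t₂ τ => Q (t₁ + t₂) τ) :
    Reaches m (.seq c₁ c₂) σ Q := by
  obtain ⟨t₁, σ', h₁, t₂, τ, h₂, hQ⟩ := h
  exact ⟨_, _, Run.seq h₁ h₂, hQ⟩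

theorem Reaches.block_seq {l : List Instr} (h : FitsAll m l σ)
    (hc : Reaches m c (execs l σ) fun t τ => Q (l.length + t) τ) :
    Reaches m (.seq (RealRAM.block l) c) σ Q :=
  Reaches.seq (Reaches.block h hc)

theorem Reaches.cond (h₁ : b.Holds σ → Reaches m c₁ σ fun t τ => Q (t + 1) τ)
    (h₂ : ¬ b.Holds σ → Reaches m c₂ σ fun t τ => Q (t + 1) τ) :
    Reaches m (.cond b c₁ c₂) σ Q := by
  by_cases hb : b.Holds σ
  · obtain ⟨t, τ, h, hQ⟩ := h₁ hb
    exact ⟨_, _, Run.cond_true hb h, hQ⟩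
  · obtain ⟨t, τ, h, hQ⟩ := h₂ hb
    exact ⟨_, _, Run.cond_false hb h, hQ⟩

/-- Loops, by an invariant with a time budget: `I N σ` allows at most `N` more steps. -/
theorem Reaches.loop {I : ℕ → State → Prop}
    (hI : ∀ N σ, I N σ → 1 ≤ N ∧ (b.Holds σ →
      Reaches m c σ fun t τ => ∃ N', t + N' + 1 ≤ N ∧ I N' τ)) :
    ∀ N σ, I N σ → Reaches m (.loop b c) σ
      fun t τ => ∃ N', t + N' ≤ N ∧ I (N' + 1) τ ∧ ¬ b.Holds τ := by
  intro N
  induction N using Nat.strong_induction_on with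
  | _ N ih =>
    intro σ hσ
    obtain ⟨h1, h2⟩ := hI N σ hσ
    by_cases hb : b.Holds σ
    · obtain ⟨t, σ', hr, N', hN, hσ'⟩ := h2 hb
      obtain ⟨t', τ, hr', N'', hN', hτ, hb'⟩ := ih N' (by omega) σ' hσ'
      exact ⟨_, _, Run.loop_true hb hr hr', N'', by omega, hτ, hb'⟩
    · obtain ⟨N, rfl⟩ := Nat.exists_eq_add_of_le' h1
      exact ⟨_, _, Run.loop_false hb, N, by omega, hσ, hb⟩

/-! ### Tournament trees -/

/-- The keys of the tournament tree. -/
def State.key (n : ℕ) (σ : State) (l : ℕ) : ℝ := σ.rmem (2 * n + l)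

/-- In the binary tree on the positive integers, `v` is an ancestor of `w` (or `w` itself). -/
def Anc (v w : ℕ) : Prop := ∃ e, w / 2 ^ e = v

theorem anc_self (v : ℕ) : Anc v v := ⟨0, by simp⟩

theorem anc_iff {v w : ℕ} : Anc v w ↔ v = w ∨ Anc v (w / 2) := by
  constructor
  · rintro ⟨e, rfl⟩
    cases e with
    | zero => left; simp
    | succ e => exact .inr ⟨e, by rw [Nat.div_div_eq_div_mul, pow_succ']⟩
  · rintro (rfl | ⟨e, rfl⟩)
    · exact anc_self _
    · exact ⟨e + 1, by rw [Nat.div_div_eq_div_mul, pow_succ']⟩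

theorem Anc.le {v w : ℕ} (h : Anc v w) : v ≤ w := by
  obtain ⟨e, rfl⟩ := h
  exact Nat.div_le_self _ _

theorem Anc.child {v w : ℕ} (h : Anc v w) (hne : v ≠ w) : Anc (2 * v) w ∨ Anc (2 * v + 1) w := by
  obtain ⟨e, rfl⟩ := h
  cases e with
  | zero => simp at hne
  | succ e =>
    have h : w / 2 ^ (e + 1) = w / 2 ^ e / 2 := by rw [Nat.div_div_eq_div_mul, pow_succ]
    have h' := Nat.div_add_mod (w / 2 ^ e) 2
    rw [h]
    rcases Nat.mod_two_eq_zero_or_one (w / 2 ^ e) with h0 | h0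
    · exact .inl ⟨e, by omega⟩
    · exact .inr ⟨e, by omega⟩

theorem Anc.of_child {u v w : ℕ} (h : Anc u w) (hu : u / 2 = v) : Anc v w := by
  obtain ⟨e, rfl⟩ := h
  exact ⟨e + 1, by rw [pow_succ, ← Nat.div_div_eq_div_mul, hu]⟩

theorem anc_one {w : ℕ} (h : 1 ≤ w) : Anc 1 w := by
  induction w using Nat.strong_induction_on with
  | _ w ih =>
    rcases h.eq_or_lt with rfl | h'
    · exact anc_self 1
    · exact anc_iff.2 (.inr (ih (w / 2) (by omega) (by omega)))

/-- The node `i` of the tree with the leaves `n, …, 2 n - 1` holds the number of a leaf below it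
that has the largest key among these. -/
structure Good (n : ℕ) (tree : ℕ → ℕ) (key : ℕ → ℝ) (i : ℕ) : Prop where
  lt : tree i < n
  anc : Anc i (n + tree i)
  le : ∀ l < n, Anc i (n + l) → key l ≤ key (tree i)

variable {n i j : ℕ} {tree : ℕ → ℕ} {key : ℕ → ℝ}

theorem good_leaf (hj : j < n) (h : tree (n + j) = j) : Good n tree key (n + j) where
  lt := by rwa [h]
  anc := by rw [h]; exact anc_self _
  le := by
    intro l hl ha
    rcases anc_iff.1 ha with ha | ha
    · rw [h, show l = j by omega]
    · have := ha.le
      omega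

/-- As `i < n`, the node `i` is not a leaf, so each leaf below it is below one of its children. -/
theorem good_node {v : ℕ} (hi : i < n) (h₁ : Good n tree key (2 * i))
    (h₂ : Good n tree key (2 * i + 1)) (hv : v = tree (2 * i) ∨ v = tree (2 * i + 1))
    (k₁ : key (tree (2 * i)) ≤ key v) (k₂ : key (tree (2 * i + 1)) ≤ key v) :
    Good n (Function.update tree i v) key i := by
  constructor
  · rw [Function.update_self]
    rcases hv with rfl | rfl
    · exact h₁.lt
    · exact h₂.lt
  · rw [Function.update_self]
    rcases hv with rfl | rfl
    · exact h₁.anc.of_child (by omega)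
    · exact h₂.anc.of_child (by omega)
  · intro l hl ha
    rw [Function.update_self]
    rcases ha.child (by omega) with ha | ha
    · exact (h₁.le l hl ha).trans k₁
    · exact (h₂.le l hl ha).trans k₂

theorem Good.congr {tree' : ℕ → ℕ} {key' : ℕ → ℝ} (h : Good n tree key i) (ht : tree' i = tree i)
    (hk : ∀ l < n, Anc i (n + l) → key' l = key l) : Good n tree' key' i := by
  refine ⟨by rw [ht]; exact h.lt, by rw [ht]; exact h.anc, fun l hl ha => ?_⟩
  rw [ht, hk l hl ha, hk _ h.lt h.anc]
  exact h.le l hl ha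

/-- The registers that hold constants during the whole sweep. -/
structure Ctx (n : ℕ) (σ : State) : Prop where
  two : σ.ireg 4 = 2
  one : σ.ireg 3 = 1
  size : σ.ireg 2 = n
  base : σ.ireg 12 = 2 * n

/-- Recompute the node `i` (register `8`) of the tournament tree from its children. -/
def pull : Prog :=
  .seq (block [.iop .mul 20 4 8, .iload 21 20, .iop .add 20 20 3, .iload 22 20,
    .iop .add 23 12 21, .rload 20 23, .iop .add 23 12 22, .rload 21 23])
  (.cond (.rle 20 21) (block [.istore 8 22]) (block [.istore 8 21]))

/-- Registers with numbers from `20` on are scratch space; here and below, the preservation claims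
concern only the registers below `20`. -/
theorem reaches_pull (hm : 3 * n + 5 ≤ m) (hctx : Ctx n σ) (hi : σ.ireg 8 < n)
    (h₁ : Good n σ.imem (σ.key n) (2 * σ.ireg 8))
    (h₂ : Good n σ.imem (σ.key n) (2 * σ.ireg 8 + 1)) :
    Reaches m pull σ fun t τ => t ≤ 10 ∧ τ.rmem = σ.rmem ∧ (∀ k < 20, τ.ireg k = σ.ireg k) ∧
      (∀ k < 20, τ.rreg k = σ.rreg k) ∧
      (∀ k, k ≠ σ.ireg 8 → τ.imem k = σ.imem k) ∧ Good n τ.imem (τ.key n) (σ.ireg 8) := by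
  have g1 := h₁.lt
  have g2 := h₂.lt
  refine Reaches.block_seq ?_ (Reaches.cond (fun hb => Reaches.block ?_ ?_)
    (fun hb => Reaches.block ?_ ?_))
  · simp [FitsAll, Instr.Fits, Instr.exec, IdxOp.eval, hctx.two, hctx.one,
      hctx.base]
    omega
  · simp [FitsAll, Instr.Fits, Instr.exec, execs]
    omega
  · simp [Test.Holds, Instr.exec, execs, IdxOp.eval, hctx.two, hctx.one,
      hctx.base] at hb
    -- Lets `simp` discard the updates of scratch registers.
    have hk : ∀ k < 20, ∀ c ≥ 20, (k = c) = False := fun k hk c hc => by simp; omega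
    refine ⟨by simp, by simp [Instr.exec, execs], ?_, ?_, ?_, ?_⟩
    · intro k hk'
      simp [Instr.exec, execs, hk k hk']
    · intro k hk'
      simp [Instr.exec, execs, hk k hk']
    · intro k hk'
      simp [Instr.exec, execs, hk']
    · simp [Instr.exec, execs, IdxOp.eval, hctx.two, hctx.one]
      exact good_node hi h₁ h₂ (.inr rfl) hb le_rfl
  · simp [FitsAll, Instr.Fits, Instr.exec, execs]
    omega
  · simp [Test.Holds, Instr.exec, execs, IdxOp.eval, hctx.two, hctx.one,
      hctx.base] at hb
    have hk : ∀ k < 20, ∀ c ≥ 20, (k = c) = False := fun k hk c hc => by simp; omega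
    refine ⟨by simp, by simp [Instr.exec, execs], ?_, ?_, ?_, ?_⟩
    · intro k hk'
      simp [Instr.exec, execs, hk k hk']
    · intro k hk'
      simp [Instr.exec, execs, hk k hk']
    · intro k hk'
      simp [Instr.exec, execs, hk']
    · simp [Instr.exec, execs, IdxOp.eval, hctx.two, hctx.one]
      exact good_node hi h₁ h₂ (.inl rfl) le_rfl hb.le

theorem Ctx.congr {τ : State} (h : Ctx n σ) (h' : ∀ k ∈ [2, 3, 4, 12], τ.ireg k = σ.ireg k) :
    Ctx n τ :=
  ⟨by rw [h' 4 (by simp), h.two], by rw [h' 3 (by simp), h.one], by rw [h' 2 (by simp), h.size],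
    by rw [h' 12 (by simp), h.base]⟩

/-- Recompute all ancestors of the node in register `8`, including that node. -/
def climb : Prog := .loop (.ile 3 8) (.seq pull (block [.iop .div 8 8 4]))

/-- The number of ancestors of the node `i`. -/
def depth (i : ℕ) : ℕ := if i = 0 then 0 else Nat.log 2 i + 1

theorem depth_half (hi : 1 ≤ i) : depth (i / 2) + 1 = depth i := by
  rcases hi.eq_or_lt with rfl | hi
  · simp [depth]
  · have h := Nat.log_of_one_lt_of_le (by norm_num : 1 < 2) (show 2 ≤ i from hi)
    rw [depth, depth, if_neg (by omega), if_neg (by omega), h]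

/-- The loop invariant is that every node outside the path from the current node to the root is
good. At node `0` the path has been used up. -/
theorem reaches_climb (hm : 3 * n + 5 ≤ m) (hctx : Ctx n σ) (hi : σ.ireg 8 < n)
    (h : ∀ v, 1 ≤ v → v < 2 * n → ¬ Anc v (σ.ireg 8) → Good n σ.imem (σ.key n) v) :
    Reaches m climb σ fun t τ => t ≤ 12 * depth (σ.ireg 8) + 1 ∧ τ.rmem = σ.rmem ∧
      (∀ k < 20, k ≠ 8 → τ.ireg k = σ.ireg k) ∧ (∀ k < 20, τ.rreg k = σ.rreg k) ∧
      (∀ k, n ≤ k → τ.imem k = σ.imem k) ∧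
      ∀ v, 1 ≤ v → v < 2 * n → Good n τ.imem (τ.key n) v := by
  let I : ℕ → State → Prop := fun N τ => N = 12 * depth (τ.ireg 8) + 1 ∧ τ.rmem = σ.rmem ∧
    (∀ k < 20, k ≠ 8 → τ.ireg k = σ.ireg k) ∧ (∀ k < 20, τ.rreg k = σ.rreg k) ∧
    (∀ k, n ≤ k → τ.imem k = σ.imem k) ∧ τ.ireg 8 < n ∧
    ∀ v, 1 ≤ v → v < 2 * n → ¬ Anc v (τ.ireg 8) → Good n τ.imem (τ.key n) v
  refine (Reaches.loop (I := I) ?_ _ σ ⟨rfl, rfl, fun _ _ _ => rfl, fun _ _ => rfl, fun _ _ => rfl,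
    hi, h⟩).mono ?_
  · rintro N τ ⟨rfl, h1, h2, h3, h4, h5, h6⟩
    refine ⟨by omega, fun hb => ?_⟩
    have hc : Ctx n τ := hctx.congr (by
      intro k hk
      fin_cases hk <;> exact h2 _ (by norm_num) (by norm_num))
    have hb : 1 ≤ τ.ireg 8 := by simpa [Test.Holds, hc.one] using hb
    refine Reaches.seq ((reaches_pull hm hc h5 ?_ ?_).mono ?_)
    · exact h6 _ (by omega) (by omega) fun ha => by have := ha.le; omega
    · exact h6 _ (by omega) (by omega) fun ha => by have := ha.le; omega
    · rintro t τ' ⟨ht, k1, k2, k3, k4, k5⟩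
      have e8 := k2 8 (by norm_num)
      have e4 : τ'.ireg 4 = 2 := by rw [k2 4 (by norm_num), hc.two]
      -- At most ten steps for `pull`, one for the division and one for the test: twelve per level.
      refine Reaches.block ?_ ⟨12 * depth (τ.ireg 8 / 2) + 1, ?_, ?_⟩
      · simp [FitsAll, Instr.Fits, IdxOp.eval, e8, e4]
        omega
      · have := depth_half hb
        simp
        omega
      · refine ⟨?_, ?_, ?_, ?_, ?_, ?_, ?_⟩
        · simp [execs, Instr.exec, IdxOp.eval, e8, e4]
        · simp [execs, Instr.exec, k1, h1]
        · intro k hk hk'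
          simp [execs, Instr.exec, Function.update_of_ne hk', k2 k hk, h2 k hk hk']
        · intro k hk
          simp [execs, Instr.exec, k3 k hk, h3 k hk]
        · intro k hk
          simp [execs, Instr.exec, k4 k (by omega), h4 k hk]
        · simp [execs, Instr.exec, IdxOp.eval, e8, e4]
          omega
        · intro v hv1 hv2
          simp only [execs, Instr.exec, IdxOp.eval, e8, e4, Function.update_self]
          intro ha
          -- The only node that leaves the path is the one just recomputed.
          by_cases hv : v = τ.ireg 8
          · rw [hv]; exact k5
          · refine (h6 v hv1 hv2 fun h' => ?_).congr (k4 v hv) ?_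
            · exact (anc_iff.1 h').elim hv ha
            · intro l _ _
              simp [State.key, k1]
  · rintro t τ ⟨N', hN, ⟨-, h1, h2, h3, h4, h5, h6⟩, hb⟩
    have e3 : τ.ireg 3 = 1 := by rw [h2 3 (by norm_num) (by norm_num), hctx.one]
    have hb : τ.ireg 8 = 0 := by simpa [Test.Holds, e3] using hb
    refine ⟨by omega, h1, h2, h3, h4, fun v hv1 hv2 => h6 v hv1 hv2 fun ha => ?_⟩
    have := ha.le
    omega

/-- Compute all inner nodes of the tournament tree. -/
def build : Prog :=
  .seq (block [.iop .sub 8 2 3]) (.loop (.ile 3 8) (.seq pull (block [.iop .sub 8 8 3])))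

theorem reaches_build (hm : 3 * n + 5 ≤ m) (hctx : Ctx n σ)
    (h : ∀ v, n ≤ v → v < 2 * n → Good n σ.imem (σ.key n) v) :
    Reaches m build σ fun t τ => t ≤ 12 * n + 2 ∧ τ.rmem = σ.rmem ∧
      (∀ k < 20, k ≠ 8 → τ.ireg k = σ.ireg k) ∧ (∀ k < 20, τ.rreg k = σ.rreg k) ∧
      (∀ k, n ≤ k → τ.imem k = σ.imem k) ∧
      ∀ v, 1 ≤ v → v < 2 * n → Good n τ.imem (τ.key n) v := by
  let I : ℕ → State → Prop := fun N τ => N = 12 * τ.ireg 8 + 1 ∧ τ.rmem = σ.rmem ∧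
    (∀ k < 20, k ≠ 8 → τ.ireg k = σ.ireg k) ∧ (∀ k < 20, τ.rreg k = σ.rreg k) ∧
    (∀ k, n ≤ k → τ.imem k = σ.imem k) ∧ τ.ireg 8 ≤ n - 1 ∧
    ∀ v, τ.ireg 8 < v → v < 2 * n → Good n τ.imem (τ.key n) v
  refine Reaches.block_seq ?_ ((Reaches.loop (I := I) ?_ (12 * (n - 1) + 1) _ ?_).mono ?_)
  · simp [FitsAll, Instr.Fits, IdxOp.eval, hctx.size, hctx.one]
    omega
  · rintro N τ ⟨rfl, h1, h2, h3, h4, h5, h6⟩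
    refine ⟨by omega, fun hb => ?_⟩
    have hc : Ctx n τ := hctx.congr (by
      intro k hk
      fin_cases hk <;> exact h2 _ (by norm_num) (by norm_num))
    have hb : 1 ≤ τ.ireg 8 := by simpa [Test.Holds, hc.one] using hb
    refine Reaches.seq ((reaches_pull hm hc (by omega) ?_ ?_).mono ?_)
    · exact h6 _ (by omega) (by omega)
    · exact h6 _ (by omega) (by omega)
    · rintro t τ' ⟨ht, k1, k2, k3, k4, k5⟩
      have e8 := k2 8 (by norm_num)
      have e3 : τ'.ireg 3 = 1 := by rw [k2 3 (by norm_num), hc.one]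
      refine Reaches.block ?_ ⟨12 * (τ.ireg 8 - 1) + 1, ?_, ?_⟩
      · simp [FitsAll, Instr.Fits, IdxOp.eval, e8, e3]
        omega
      · simp
        omega
      · refine ⟨?_, ?_, ?_, ?_, ?_, ?_, ?_⟩
        · simp [execs, Instr.exec, IdxOp.eval, e8, e3]
        · simp [execs, Instr.exec, k1, h1]
        · intro k hk hk'
          simp [execs, Instr.exec, Function.update_of_ne hk', k2 k hk, h2 k hk hk']
        · intro k hk
          simp [execs, Instr.exec, k3 k hk, h3 k hk]
        · intro k hk
          simp [execs, Instr.exec, k4 k (by omega), h4 k hk]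
        · simp [execs, Instr.exec, IdxOp.eval, e8, e3]
          omega
        · intro v
          simp only [execs, Instr.exec, IdxOp.eval, e8, e3, Function.update_self]
          intro hv1 hv2
          by_cases hv : v = τ.ireg 8
          · rw [hv]; exact k5
          · refine (h6 v (by omega) hv2).congr (k4 v hv) ?_
            intro l _ _
            simp [State.key, k1]
  · refine ⟨?_, rfl, ?_, fun _ _ => rfl, fun _ _ => rfl, ?_, ?_⟩
    · simp [execs, Instr.exec, IdxOp.eval, hctx.size, hctx.one]
    · intro k hk hk'
      simp [execs, Instr.exec, Function.update_of_ne hk']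
    · simp [execs, Instr.exec, IdxOp.eval, hctx.size, hctx.one]
    · intro v
      simp only [execs, Instr.exec, IdxOp.eval, hctx.size, hctx.one, Function.update_self]
      intro hv1 hv2
      exact h v (by omega) hv2
  · rintro t τ ⟨N', hN, ⟨-, h1, h2, h3, h4, h5, h6⟩, hb⟩
    have e3 : τ.ireg 3 = 1 := by rw [h2 3 (by norm_num) (by norm_num), hctx.one]
    have hb : τ.ireg 8 = 0 := by simpa [Test.Holds, e3] using hb
    refine ⟨by simp; omega, h1, h2, h3, h4, fun v hv1 hv2 => h6 v (by omega) hv2⟩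

/-- Write the leaves of the tournament tree and their keys. -/
def fill : Prog :=
  .seq (block [.imove 5 2]) (.loop (.ile 3 5) (block [.iop .sub 5 5 3, .iop .add 20 12 5,
    .iop .mul 21 4 5, .iop .add 21 21 3, .rload 20 21, .rop .mul 20 3 20, .rfun .arctan 20 20,
    .rstore 20 20, .iop .add 21 2 5, .istore 21 5]))

/-- Taking arctangents keeps the order of the heights and makes all keys larger than `-2`, which can
then mark removed points. -/
theorem reaches_fill (hm : 3 * n + 5 ≤ m) (hctx : Ctx n σ) :
    Reaches m fill σ fun t τ => t ≤ 11 * n + 2 ∧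
      (∀ k < 20, k ≠ 5 → τ.ireg k = σ.ireg k) ∧ (∀ k < 20, τ.rreg k = σ.rreg k) ∧
      (∀ k < 2 * n, τ.rmem k = σ.rmem k) ∧
      (∀ l < n, τ.key n l = Real.arctan (σ.rreg 3 * σ.rmem (2 * l + 1)) ∧
        τ.imem (n + l) = l) := by
  let I : ℕ → State → Prop := fun N τ => N = 11 * τ.ireg 5 + 1 ∧
    (∀ k < 20, k ≠ 5 → τ.ireg k = σ.ireg k) ∧ (∀ k < 20, τ.rreg k = σ.rreg k) ∧
    (∀ k < 2 * n, τ.rmem k = σ.rmem k) ∧ τ.ireg 5 ≤ n ∧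
    (∀ l < n, τ.ireg 5 ≤ l → τ.key n l = Real.arctan (σ.rreg 3 * σ.rmem (2 * l + 1)) ∧
        τ.imem (n + l) = l)
  refine Reaches.block_seq ?_ ((Reaches.loop (I := I) ?_ (11 * n + 1) _ ?_).mono ?_)
  · simp [FitsAll, Instr.Fits]
  · rintro N τ ⟨rfl, h2, h3, h4, h5, h6⟩
    refine ⟨by omega, fun hb => ?_⟩
    have hc : Ctx n τ := hctx.congr (by
      intro k hk
      fin_cases hk <;> exact h2 _ (by norm_num) (by norm_num))
    have hb : 1 ≤ τ.ireg 5 := by simpa [Test.Holds, hc.one] using hb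
    have e3 := h3 3 (by norm_num)
    obtain ⟨j, hj⟩ := Nat.exists_eq_add_of_le' hb
    have hk : ∀ k < 20, ∀ c ≥ 20, (k = c) = False := fun k hk c hc => by simp; omega
    refine Reaches.block ?_ ⟨11 * j + 1, ?_, ?_⟩
    · simp [FitsAll, Instr.Fits, Instr.exec, IdxOp.eval, hc.two, hc.one,
        hc.base, hc.size, hj]
      omega
    · simp [hj]
      omega
    · refine ⟨?_, ?_, ?_, ?_, ?_, ?_⟩
      · simp [execs, Instr.exec, IdxOp.eval, hj, hc.one]
      · intro k hk1 hk2
        simp [execs, Instr.exec, hk k hk1, hk2, h2 k hk1 hk2]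
      · intro k hk1
        simp [execs, Instr.exec, hk k hk1, h3 k hk1]
      · intro k hk1
        have : k ≠ 2 * n + j := by omega
        simp [execs, Instr.exec, IdxOp.eval, hc.base, hc.one, hj, this,
          h4 k hk1]
      · simp [execs, Instr.exec, IdxOp.eval, hj, hc.one]
        omega
      · intro l hl
        simp [execs, Instr.exec, IdxOp.eval, hj, hc.one, hc.base, hc.two, hc.size, State.key,
          RealFun.eval, RealOp.eval, e3, Function.update_apply]
        intro hjl
        rcases hjl.eq_or_lt with rfl | hjl
        · simp [h4 (2 * j + 1) (by omega)]
        · simpa [hjl.ne', State.key] using h6 l hl (by omega)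
  · refine ⟨?_, ?_, fun _ _ => rfl, fun _ _ => rfl, ?_, ?_⟩
    · simp [execs, Instr.exec, hctx.size]
    · intro k hk hk'
      simp [execs, Instr.exec, Function.update_of_ne hk']
    · simp [execs, Instr.exec, hctx.size]
    · intro l hl
      simp only [execs, Instr.exec, hctx.size, Function.update_self]
      intro hl'
      omega
  · rintro t τ ⟨N', hN, ⟨-, h2, h3, h4, h5, h6⟩, hb⟩
    have e3 : τ.ireg 3 = 1 := by rw [h2 3 (by norm_num) (by norm_num), hctx.one]
    have hb : τ.ireg 5 = 0 := by simpa [Test.Holds, e3] using hb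
    refine ⟨by simp; omega, h2, h3, h4, fun l hl => h6 l hl (by omega)⟩

end RealRAM

/-! ### Processing a single point on the machine. -/

namespace RealRAM

open Sweep

variable {m n : ℕ} {σ : State}

/-- The index memory holds the list `l` as a stack that starts at the address `base`. -/
def StackAt (base : ℕ) (mem : ℕ → ℕ) : List ℕ → Prop
  | [] => True
  | a :: l => mem (base + l.length) = a ∧ StackAt base mem l

theorem StackAt.congr {base : ℕ} {mem mem' : ℕ → ℕ} {l : List ℕ} (h : StackAt base mem l)
    (h' : ∀ k, base ≤ k → k < base + l.length → mem' k = mem k) : StackAt base mem' l := by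
  induction l with
  | nil => trivial
  | cons a l ih =>
    refine ⟨(h' _ (by omega) (by simp)).trans h.1, ih h.2 fun k h1 h2 => h' k h1 ?_⟩
    simp
    omega

/-- The point `j` has the coordinates `x j` and `y j`, after scaling. -/
structure Points (n : ℕ) (x y : ℕ → ℝ) (σ : State) : Prop where
  fst : ∀ j < n, σ.rreg 2 * σ.rmem (2 * j) = x j
  snd : ∀ j < n, σ.rreg 3 * σ.rmem (2 * j + 1) = y j

theorem Points.congr {x y : ℕ → ℝ} {τ : State} (h : Points n x y σ) (h2 : τ.rreg 2 = σ.rreg 2)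
    (h3 : τ.rreg 3 = σ.rreg 3) (hmem : ∀ k < 2 * n, τ.rmem k = σ.rmem k) : Points n x y τ :=
  ⟨fun j hj => by rw [h2, hmem _ (by omega), h.fst j hj],
    fun j hj => by rw [h3, hmem _ (by omega), h.snd j hj]⟩

/-- Pop the topmost point of the stack if it is beaten by the next one. Register `9` says whether
this happened. -/
def popBody : Prog :=
  .seq (block [.iconst 9 0]) (.cond (.ile 4 6)
    (.seq (block [.iop .add 20 12 6, .iop .sub 20 20 3, .iload 21 20, .iop .sub 20 20 3,
      .iload 22 20,
      .iop .mul 23 4 21, .rload 20 23, .rop .mul 20 2 20, .iop .add 23 23 3, .rload 21 23,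
      .rop .mul 21 3 21,
      .iop .mul 23 4 22, .rload 22 23, .rop .mul 22 2 22, .iop .add 23 23 3, .rload 23 23,
      .rop .mul 23 3 23,
      .rop .sub 24 22 20, .rop .sub 25 23 21, .rop .div 24 24 25,
      .rop .sub 25 20 5, .rop .sub 26 21 6, .rop .div 25 25 26])
    (.cond (.rle 25 24) (block [.iop .sub 6 6 3, .iconst 9 1]) .skip)) .skip)

theorem reaches_popBody {x y : ℕ → ℝ} {z : ℕ} {l : List ℕ} (hm : 3 * n + 5 ≤ m) (hctx : Ctx n σ)
    (hpts : Points n x y σ) (hx : σ.rreg 5 = x z) (hy : σ.rreg 6 = y z)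
    (hl : StackAt (2 * n) σ.imem l) (hlen : σ.ireg 6 = l.length) (hn : l.length ≤ n)
    (hlt : ∀ s ∈ l, s < n) :
    Reaches m popBody σ fun t τ => t ≤ 28 ∧ τ.rmem = σ.rmem ∧ τ.imem = σ.imem ∧
      (∀ k < 20, k ≠ 6 → k ≠ 9 → τ.ireg k = σ.ireg k) ∧ (∀ k < 20, τ.rreg k = σ.rreg k) ∧
      ((τ.ireg 9 = 1 ∧ ∃ p q l', l = p :: q :: l' ∧ slope x y z p ≤ slope x y p q ∧
          τ.ireg 6 = l'.length + 1) ∨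
        (τ.ireg 9 = 0 ∧ Settled x y z l ∧ τ.ireg 6 = l.length)) := by
  have hk : ∀ k < 20, ∀ c ≥ 20, (k = c) = False := fun k hk c hc => by simp; omega
  refine Reaches.block_seq ?_ (Reaches.cond (fun hb => ?_) (fun hb => Reaches.skip ?_))
  · simp [FitsAll, Instr.Fits]
  · simp [Test.Holds, execs, Instr.exec, hctx.two, hlen] at hb
    obtain ⟨p, q, l, rfl⟩ : ∃ p q l', l = p :: q :: l' := by
      match l, hb with
      | p :: q :: l', _ => exact ⟨p, q, l', rfl⟩
    have hp := hlt p (by simp)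
    have hq := hlt q (by simp)
    obtain ⟨m1, m2, -⟩ := hl
    rw [List.length_cons] at m1
    have a1 : 2 * n + (l.length + 1 + 1) - 1 = 2 * n + (l.length + 1) := by omega
    have a2 : 2 * n + (l.length + 1) - 1 = 2 * n + l.length := by omega
    have c1 := hpts.fst p hp
    have c2 := hpts.snd p hp
    have c3 := hpts.fst q hq
    have c4 := hpts.snd q hq
    simp at hn
    refine Reaches.block_seq ?_ (Reaches.cond (fun hb => Reaches.block ?_ ?_)
      (fun hb => Reaches.skip ?_))
    · simp [FitsAll, Instr.Fits, Instr.exec, execs, IdxOp.eval, hctx.two, hctx.one, hctx.base,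
        hlen, a1, a2, m1, m2]
      omega
    · simp [FitsAll, Instr.Fits, Instr.exec, execs, IdxOp.eval, hctx.one, hlen]
      omega
    · simp [Test.Holds, Instr.exec, execs, IdxOp.eval, RealOp.eval, hctx.two, hctx.one, hctx.base,
        hlen, a1, a2, m1, m2, c1, c2, c3, c4, hx, hy] at hb
      refine ⟨by simp, by simp [execs, Instr.exec], by simp [execs, Instr.exec], ?_, ?_, .inl ?_⟩
      · intro k h1 h2 h3
        simp [execs, Instr.exec, h2, h3, hk k h1]
      · intro k h1
        simp [execs, Instr.exec, hk k h1]
      · exact ⟨by simp [execs, Instr.exec], p, q, l, rfl, hb,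
          by simp [execs, Instr.exec, IdxOp.eval, hctx.one, hlen]⟩
    · simp [Test.Holds, Instr.exec, execs, IdxOp.eval, RealOp.eval, hctx.two, hctx.one, hctx.base,
        hlen, a1, a2, m1, m2, c1, c2, c3, c4, hx, hy] at hb
      refine ⟨by simp, by simp [execs, Instr.exec], by simp [execs, Instr.exec], ?_, ?_, .inr ?_⟩
      · intro k h1 h2 h3
        simp [execs, Instr.exec, h3, hk k h1]
      · intro k h1
        simp [execs, Instr.exec, hk k h1]
      · refine ⟨by simp [execs, Instr.exec], ?_, by simp [execs, Instr.exec, hlen]⟩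
        intro p' hp' q' hq'
        simp at hp' hq'
        subst hp' hq'
        exact hb.le
  · simp [Test.Holds, execs, Instr.exec, hctx.two, hlen] at hb
    refine ⟨by simp, by simp [execs, Instr.exec], by simp [execs, Instr.exec], ?_, ?_, .inr ?_⟩
    · intro k h1 h2 h3
      simp [execs, Instr.exec, h3]
    · intro k h1
      simp [execs, Instr.exec]
    · refine ⟨by simp [execs, Instr.exec], ?_, by simp [execs, Instr.exec, hlen]⟩
      match l, hb with
      | [], _ => intro p hp; simp at hp
      | [a], _ => intro p hp q hq; simp at hq

/-- Pop all points that are beaten by the next one. -/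
def popLoop : Prog := .seq (block [.iconst 9 1]) (.loop (.ile 3 9) popBody)

/-- Each stack entry carries a credit of `30` steps, which pays for the iteration that pops it; the
last, unsuccessful iteration is paid for by the flag in register `9`. -/
theorem reaches_popLoop {x y : ℕ → ℝ} {z : ℕ} {D : Finset ℕ} {red : ℕ → Prop} {T : ℝ}
    {stack : List ℕ} (hm : 3 * n + 5 ≤ m) (hctx : Ctx n σ)
    (hpts : Points n x y σ) (hx : σ.rreg 5 = x z) (hy : σ.rreg 6 = y z)
    (hl : StackAt (2 * n) σ.imem stack) (hlen : σ.ireg 6 = stack.length) (hn : stack.length ≤ n)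
    (hD : ∀ r ∈ D, r < n) (hz : ∀ r ∈ D, y z < y r) (hpop : PopInv x y D red z T stack) :
    Reaches m popLoop σ fun t τ => τ.rmem = σ.rmem ∧ τ.imem = σ.imem ∧
      (∀ k < 20, k ≠ 6 → k ≠ 9 → τ.ireg k = σ.ireg k) ∧ (∀ k < 20, τ.rreg k = σ.rreg k) ∧
      ∃ l, PopInv x y D red z T l ∧ Settled x y z l ∧ StackAt (2 * n) τ.imem l ∧
        τ.ireg 6 = l.length ∧ l.length ≤ stack.length ∧
        t + 30 * l.length ≤ 30 * stack.length + 40 := by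
  let I : ℕ → State → Prop := fun N τ => τ.rmem = σ.rmem ∧ τ.imem = σ.imem ∧
    (∀ k < 20, k ≠ 6 → k ≠ 9 → τ.ireg k = σ.ireg k) ∧ (∀ k < 20, τ.rreg k = σ.rreg k) ∧
    ∃ l, PopInv x y D red z T l ∧ StackAt (2 * n) τ.imem l ∧
      τ.ireg 6 = l.length ∧ l.length ≤ stack.length ∧ N = 30 * (l.length + τ.ireg 9) + 1 ∧
      (τ.ireg 9 = 1 ∨ (τ.ireg 9 = 0 ∧ Settled x y z l))
  refine Reaches.block_seq ?_ ((Reaches.loop (I := I) ?_ (30 * (stack.length + 1) + 1) _ ?_).mono ?_)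
  · simp [FitsAll, Instr.Fits]
    omega
  · rintro N τ ⟨h1, h2, h3, h4, l, h5, h6, h7, h8, rfl, h9⟩
    refine ⟨by omega, fun hb => ?_⟩
    have hc : Ctx n τ := hctx.congr (by
      intro k hk
      fin_cases hk <;> exact h3 _ (by norm_num) (by norm_num) (by norm_num))
    have hb : 1 ≤ τ.ireg 9 := by simpa [Test.Holds, hc.one] using hb
    have h9 : τ.ireg 9 = 1 := h9.resolve_right (by omega)
    refine (reaches_popBody hm hc (hpts.congr (h4 2 (by norm_num)) (h4 3 (by norm_num))
      fun k _ => by rw [h1]) (by rw [h4 5 (by norm_num), hx]) (by rw [h4 6 (by norm_num), hy])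
      h6 h7 (h8.trans hn) (fun s hs => hD s (h5.mem s hs).1)).mono ?_
    rintro t τ' ⟨ht, k1, k2, k3, k4, k5⟩
    have f3 : ∀ k < 20, k ≠ 6 → k ≠ 9 → τ'.ireg k = σ.ireg k := fun k a b c => by
      rw [k3 k a b c, h3 k a b c]
    have f4 : ∀ k < 20, τ'.rreg k = σ.rreg k := fun k a => by rw [k4 k a, h4 k a]
    rcases k5 with ⟨e9, p, q, l', rfl, hs, e6⟩ | ⟨e9, hs, e6⟩
    · refine ⟨30 * (l'.length + 1 + 1) + 1, ?_, k1.trans h1, k2.trans h2, f3, f4, q :: l',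
        h5.pop hz hs, ?_, e6, ?_, ?_, .inl e9⟩
      · simp; omega
      · rw [k2]; exact h6.2
      · simp at h8 ⊢; omega
      · simp [e9]
    · refine ⟨30 * l.length + 1, ?_, k1.trans h1, k2.trans h2, f3, f4, l,
        h5, ?_, e6, h8, ?_, .inr ⟨e9, hs⟩⟩
      · simp [h9]; omega
      · rw [k2]; exact h6
      · simp [e9]
  · refine ⟨rfl, rfl, ?_, fun _ _ => rfl, stack, hpop, hl, ?_, le_rfl, ?_, .inl ?_⟩
    · intro k a b c
      simp [execs, Instr.exec, c]
    · simp [execs, Instr.exec, hlen]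
    · simp [execs, Instr.exec]
    · simp [execs, Instr.exec]
  · rintro t τ ⟨N', hN, ⟨h1, h2, h3, h4, l, h5, h6, h7, h8, hN', h9⟩, hb⟩
    have e3 : τ.ireg 3 = 1 := by rw [h3 3 (by norm_num) (by norm_num) (by norm_num), hctx.one]
    have hb : τ.ireg 9 = 0 := by simpa [Test.Holds, e3] using hb
    refine ⟨h1, h2, h3, h4, l, h5, (h9.resolve_left (by omega)).2, h6, h7, h8, ?_⟩
    simp
    omega

/-- Push the point in register `7`. -/
def push : Prog := block [.iop .add 20 12 6, .istore 20 7, .iop .add 6 6 3]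

/-- Lower the real register `0` to the value for the blue point that was loaded. -/
def lowerMin : Prog :=
  .cond (.ile 3 6)
    (.seq (block [.iop .add 20 12 6, .iop .sub 20 20 3, .iload 21 20,
      .iop .mul 23 4 21, .rload 20 23, .rop .mul 20 2 20, .iop .add 23 23 3, .rload 21 23,
      .rop .mul 21 3 21, .rop .sub 25 20 5, .rop .sub 26 21 6, .rop .div 25 25 26,
      .rfun .arctan 25 25])
    (.cond (.rle 0 25) .skip (block [.rmove 0 25])))
    (block [.rconst 20 (-1), .rfun .arcsin 0 20])

theorem reaches_lowerMin {x y : ℕ → ℝ} {z : ℕ} {l : List ℕ} (hm : 3 * n + 5 ≤ m) (hctx : Ctx n σ)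
    (hpts : Points n x y σ) (hx : σ.rreg 5 = x z) (hy : σ.rreg 6 = y z)
    (hl : StackAt (2 * n) σ.imem l) (hlen : σ.ireg 6 = l.length) (hn : l.length ≤ n)
    (hlt : ∀ s ∈ l, s < n) :
    Reaches m lowerMin σ fun t τ => t ≤ 20 ∧ τ.rmem = σ.rmem ∧ τ.imem = σ.imem ∧
      (∀ k < 20, τ.ireg k = σ.ireg k) ∧ (∀ k < 20, k ≠ 0 → τ.rreg k = σ.rreg k) ∧
      ((l = [] ∧ τ.rreg 0 = -(Real.pi / 2)) ∨
        ∃ p l', l = p :: l' ∧ τ.rreg 0 = min (σ.rreg 0) (Real.arctan (slope x y z p))) := by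
  have hk : ∀ k < 20, ∀ c ≥ 20, (k = c) = False := fun k hk c hc => by simp; omega
  refine Reaches.cond (fun hb => ?_) (fun hb => Reaches.block ?_ ?_)
  · simp [Test.Holds, hctx.one, hlen] at hb
    obtain ⟨p, l, rfl⟩ : ∃ p l', l = p :: l' := by
      match l, hb with
      | p :: l', _ => exact ⟨p, l', rfl⟩
    have hp := hlt p (by simp)
    obtain ⟨m1, -⟩ := hl
    have a1 : 2 * n + (l.length + 1) - 1 = 2 * n + l.length := by omega
    have c1 := hpts.fst p hp
    have c2 := hpts.snd p hp
    simp at hn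
    refine Reaches.block_seq ?_ (Reaches.cond (fun hb => Reaches.skip ?_)
      (fun hb => Reaches.block ?_ ?_))
    · simp [FitsAll, Instr.Fits, Instr.exec, IdxOp.eval, hctx.two, hctx.one, hctx.base,
        hlen, a1, m1]
      omega
    · simp [Test.Holds, Instr.exec, execs, IdxOp.eval, RealOp.eval, RealFun.eval, hctx.two,
        hctx.one, hctx.base, hlen, a1, m1, c1, c2, hx, hy] at hb
      refine ⟨by simp, by simp [execs, Instr.exec], by simp [execs, Instr.exec], ?_, ?_,
        .inr ⟨p, l, rfl, ?_⟩⟩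
      · intro k h1
        simp [execs, Instr.exec, hk k h1]
      · intro k h1 h2
        simp [execs, Instr.exec, hk k h1]
      · simp [execs, Instr.exec]
        exact hb
    · simp [FitsAll, Instr.Fits]
    · simp [Test.Holds, Instr.exec, execs, IdxOp.eval, RealOp.eval, RealFun.eval, hctx.two,
        hctx.one, hctx.base, hlen, a1, m1, c1, c2, hx, hy] at hb
      refine ⟨by simp, by simp [execs, Instr.exec], by simp [execs, Instr.exec], ?_, ?_,
        .inr ⟨p, l, rfl, ?_⟩⟩
      · intro k h1
        simp [execs, Instr.exec, hk k h1]
      · intro k h1 h2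
        simp [execs, Instr.exec, hk k h1, h2]
      · simp [Instr.exec, execs, IdxOp.eval, RealOp.eval, RealFun.eval, hctx.two,
          hctx.one, hctx.base, hlen, a1, m1, c1, c2, hx, hy]
        exact (min_eq_right hb.le).symm
  · simp [FitsAll, Instr.Fits]
  · simp [Test.Holds, hctx.one, hlen] at hb
    refine ⟨by simp, by simp [execs, Instr.exec], by simp [execs, Instr.exec], ?_, ?_,
      .inl ⟨hb, ?_⟩⟩
    · intro k h1
      simp [execs, Instr.exec]
    · intro k h1 h2
      simp [execs, Instr.exec, hk k h1, h2]
    · simp [execs, Instr.exec, RealFun.eval]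

/-- Process the point that was loaded. -/
def process : Prog :=
  .seq popLoop (.seq (block [.iop .add 20 7 3]) (.cond (.ile 20 0) push lowerMin))

/-- The red points come first in the input, so the colour of `z` is read off from its index. The
stack length stays on the left of the time bound, for amortization over the whole sweep. -/
theorem reaches_process {x y : ℕ → ℝ} {z : ℕ} {D : Finset ℕ} {T₀ : ℝ} {stack : List ℕ}
    (hm : 3 * n + 5 ≤ m) (hctx : Ctx n σ)
    (hpts : Points n x y σ) (h7 : σ.ireg 7 = z) (hzn : z < n) (hx : σ.rreg 5 = x z)
    (hy : σ.rreg 6 = y z)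
    (hl : StackAt (2 * n) σ.imem stack) (hlen : σ.ireg 6 = stack.length) (hn : stack.length < n)
    (hD : ∀ r ∈ D, r < n) (hz : ∀ r ∈ D, y z < y r)
    (hinv : Inv x y D (· < σ.ireg 0) T₀ stack (σ.rreg 0)) :
    Reaches m process σ fun t τ => τ.rmem = σ.rmem ∧ (∀ k < 2 * n, τ.imem k = σ.imem k) ∧
      (∀ k < 20, k ≠ 6 → k ≠ 9 → τ.ireg k = σ.ireg k) ∧
      (∀ k < 20, k ≠ 0 → τ.rreg k = σ.rreg k) ∧
      ∃ l, Inv x y (insert z D) (· < σ.ireg 0) T₀ l (τ.rreg 0) ∧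
        StackAt (2 * n) τ.imem l ∧ τ.ireg 6 = l.length ∧ l.length ≤ stack.length + 1 ∧
        t + 30 * l.length ≤ 30 * stack.length + 100 := by
  have hk : ∀ k < 20, ∀ c ≥ 20, (k = c) = False := fun k hk c hc => by simp; omega
  refine Reaches.seq ((reaches_popLoop hm hctx hpts hx hy hl hlen hn.le hD hz
    (hinv.popInv (z := z))).mono ?_)
  rintro t τ ⟨h1, h2, h3, h4, l, h5, h6, h7', h8, h9, h10⟩
  have hc : Ctx n τ := hctx.congr (by
    intro k hk
    fin_cases hk <;> exact h3 _ (by norm_num) (by norm_num) (by norm_num))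
  have e7 : τ.ireg 7 = z := by rw [h3 7 (by norm_num) (by norm_num) (by norm_num), h7]
  have e0 : τ.ireg 0 = σ.ireg 0 := h3 0 (by norm_num) (by norm_num) (by norm_num)
  have r0 : τ.rreg 0 = σ.rreg 0 := h4 0 (by norm_num)
  refine Reaches.block_seq ?_ (Reaches.cond (fun hb => Reaches.block ?_ ?_) (fun hb => ?_))
  · simp [FitsAll, Instr.Fits, IdxOp.eval, hc.one, e7]
    omega
  · simp [FitsAll, Instr.Fits, Instr.exec, execs, IdxOp.eval, hc.one, hc.base, h8]
    omega
  · simp [Test.Holds, execs, Instr.exec, IdxOp.eval, hc.one, e7, e0] at hb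
    refine ⟨?_, ?_, ?_, ?_, z :: l, ?_, ?_, ?_, ?_, ?_⟩
    · simp [execs, Instr.exec, h1]
    · intro k hk'
      have : k ≠ 2 * n + l.length := by omega
      simp [execs, Instr.exec, IdxOp.eval, hc.base, h8, this, h2]
    · intro k a b c
      simp [execs, Instr.exec, hk k a, b, h3 k a b c]
    · intro k a b
      simp [execs, Instr.exec, h4 k a]
    · simp only [execs, Instr.exec, r0]
      exact hinv.push hz hb h5 h6
    · simp only [execs, Instr.exec, StackAt]
      refine ⟨by simp [IdxOp.eval, hc.base, h8, e7], h7'.congr fun k a b => ?_⟩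
      have : k ≠ 2 * n + l.length := by omega
      simp [IdxOp.eval, hc.base, h8, this]
    · simp [execs, Instr.exec, IdxOp.eval, hc.one, h8]
    · simpa using h9
    · simp
      omega
  · simp [Test.Holds, execs, Instr.exec, IdxOp.eval, hc.one, e7, e0] at hb
    have hred : ¬ z < σ.ireg 0 := by omega
    refine (reaches_lowerMin (x := x) (y := y) (z := z) (l := l) hm ⟨?_, ?_, ?_, ?_⟩
      (hpts.congr ?_ ?_ ?_) ?_ ?_ ?_ ?_
      (h9.trans hn.le) (fun s hs => hD s (h5.mem s hs).1)).mono ?_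
    · simp [execs, Instr.exec, hc.two]
    · simp [execs, Instr.exec, hc.one]
    · simp [execs, Instr.exec, hc.size]
    · simp [execs, Instr.exec, hc.base]
    · simp [execs, Instr.exec, h4 2]
    · simp [execs, Instr.exec, h4 3]
    · intro k _
      simp [execs, Instr.exec, h1]
    · simp [execs, Instr.exec, h4 5, hx]
    · simp [execs, Instr.exec, h4 6, hy]
    · simpa [execs, Instr.exec] using h7'
    · simp [execs, Instr.exec, h8]
    · rintro t' τ' ⟨ht, k1, k2, k3, k4, k5⟩
      refine ⟨?_, ?_, ?_, ?_, l, ?_, ?_, ?_, ?_, ?_⟩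
      · simp [k1, execs, Instr.exec, h1]
      · intro k _
        simp [k2, execs, Instr.exec, h2]
      · intro k a b c
        simp [k3 k a, execs, Instr.exec, hk k a, h3 k a b c]
      · intro k a b
        simp [k4 k a b, execs, Instr.exec, h4 k a]
      · rcases k5 with ⟨rfl, e⟩ | ⟨p, l', rfl, e⟩
        · rw [e]
          exact hinv.fail hz hred h5
        · simp only [execs, Instr.exec, r0] at e
          rw [e]
          exact hinv.lower_min hz hred h5 h6
      · simpa [k2, execs, Instr.exec] using h7'
      · simp [k3 6, execs, Instr.exec, h8]
      · omega
      · simp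
        omega

end RealRAM

/-! ### The complete sweep and its amortized time. -/

namespace RealRAM

open Sweep

variable {m n : ℕ} {σ : State}

/-- Load the winner of the tournament into register `7` and its coordinates into the real
registers `5` and `6`. -/
def loadWinner : List Instr := [.iop .sub 5 5 3, .iload 7 3, .iop .mul 20 4 7, .rload 5 20,
  .rop .mul 5 2 5, .iop .add 20 20 3, .rload 6 20, .rop .mul 6 3 6]

/-- Remove the winner and find the next one. -/
def replay : Prog :=
  .seq (block [.iop .add 20 12 7, .rstore 20 4, .iop .add 8 2 7, .iop .div 8 8 4]) climb

/-- Process all points from top to bottom. -/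
def sweep : Prog := .loop (.ile 3 5) (.seq (block loadWinner) (.seq process replay))

theorem neg_two_lt_arctan (a : ℝ) : -2 < Real.arctan a := by
  linarith [Real.neg_pi_div_two_lt_arctan a, Real.pi_le_four]

/-- The keys when the points of `D` have been removed. -/
noncomputable def remainingKey (y : ℕ → ℝ) (D : Finset ℕ) (l : ℕ) : ℝ :=
  if l ∈ D then -2 else Real.arctan (y l)

theorem winner_spec {y : ℕ → ℝ} {D : Finset ℕ} {z : ℕ} (hD : D.card < n)
    (hinj : ∀ i < n, ∀ j < n, y i = y j → i = j)
    (hz : z < n) (hmax : ∀ l < n, remainingKey y D l ≤ remainingKey y D z) :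
    z ∉ D ∧ ∀ l < n, l ∉ insert z D → y l < y z := by
  have hzD : z ∉ D := by
    intro h
    -- Some point has not been removed; its key exceeds `-2`, so a removed point cannot win.
    obtain ⟨l, hl, hlD⟩ := Finset.exists_mem_notMem_of_card_lt_card
      (show D.card < (Finset.range n).card by simpa using hD)
    have := hmax l (Finset.mem_range.1 hl)
    rw [remainingKey, remainingKey, if_neg hlD, if_pos h] at this
    linarith [neg_two_lt_arctan (y l)]
  refine ⟨hzD, fun l hl hlD => ?_⟩
  rw [Finset.mem_insert, not_or] at hlD
  have := hmax l hl
  rw [remainingKey, remainingKey, if_neg hlD.2, if_neg hzD] at this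
  exact (Real.arctan_strictMono.le_iff_le.1 this).lt_of_ne fun h => hlD.1 (hinj l hl z hz h)

theorem depth_le {i : ℕ} (hi : i < n) : depth i ≤ Nat.log 2 n + 1 := by
  unfold depth
  split
  · omega
  · have := Nat.log_mono_right (b := 2) hi.le
    omega

/-- Changing the key of `z` affects only the ancestors of its leaf. The leaf itself stays good,
being the only leaf below itself, so the climb starts at its parent. -/
theorem reaches_replay {z : ℕ} (hm : 3 * n + 5 ≤ m) (hctx : Ctx n σ) (h7 : σ.ireg 7 = z)
    (hz : z < n) (hleaf : σ.imem (n + z) = z)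
    (h : ∀ v, 1 ≤ v → v < 2 * n → Good n σ.imem (σ.key n) v) :
    Reaches m replay σ fun t τ => t ≤ 12 * (Nat.log 2 n + 1) + 5 ∧
      (∀ k < 20, k ≠ 8 → τ.ireg k = σ.ireg k) ∧ (∀ k < 20, τ.rreg k = σ.rreg k) ∧
      (∀ k, n ≤ k → τ.imem k = σ.imem k) ∧ (∀ k < 2 * n, τ.rmem k = σ.rmem k) ∧
      (∀ l, τ.key n l = if l = z then σ.rreg 4 else σ.key n l) ∧
      ∀ v, 1 ≤ v → v < 2 * n → Good n τ.imem (τ.key n) v := by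
  have hk : ∀ k < 20, ∀ c ≥ 20, (k = c) = False := fun k hk c hc => by simp; omega
  have e8 : (execs [.iop .add 20 12 7, .rstore 20 4, .iop .add 8 2 7, .iop .div 8 8 4] σ).ireg 8 =
      (n + z) / 2 := by
    simp [execs, Instr.exec, IdxOp.eval, hctx.size, hctx.two, h7]
  refine Reaches.block_seq ?_ ((reaches_climb (n := n) hm ⟨?_, ?_, ?_, ?_⟩ ?_ ?_).mono ?_)
  · simp [FitsAll, Instr.Fits, Instr.exec, IdxOp.eval, hctx.size, hctx.two, hctx.base, h7]
    omega
  · simp [execs, Instr.exec, hctx.two]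
  · simp [execs, Instr.exec, hctx.one]
  · simp [execs, Instr.exec, hctx.size]
  · simp [execs, Instr.exec, hctx.base]
  · rw [e8]
    omega
  · rw [e8]
    intro v h1 h2 ha
    by_cases hv : v = n + z
    · rw [hv]
      exact good_leaf hz (by simpa [execs, Instr.exec] using hleaf)
    · refine (h v h1 h2).congr (by simp [execs, Instr.exec]) fun l hl hl' => ?_
      have hlz : l ≠ z := by
        rintro rfl
        exact (anc_iff.1 hl').elim hv ha
      simp [State.key, execs, Instr.exec, IdxOp.eval, hctx.base, h7, hlz]
  · rintro t τ ⟨ht, h1, h2, h3, h4, h5⟩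
    rw [e8] at ht
    have := depth_le (n := n) (i := (n + z) / 2) (by omega)
    refine ⟨by simp; omega, ?_, ?_, ?_, ?_, ?_, h5⟩
    · intro k a b
      simp [h2 k a b, execs, Instr.exec, hk k a, b]
    · intro k a
      simp [h3 k a, execs, Instr.exec]
    · intro k a
      simp [h4 k a, execs, Instr.exec]
    · intro k a
      have : k ≠ 2 * n + z := by omega
      simp [h1, execs, Instr.exec, IdxOp.eval, hctx.base, h7, this]
    · intro l
      simp [State.key, h1, execs, Instr.exec, IdxOp.eval, hctx.base, h7, Function.update_apply]

/-- What a sweep preserves. -/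
structure Preserved (n : ℕ) (σ τ : State) : Prop where
  ireg0 : τ.ireg 0 = σ.ireg 0
  ireg1 : τ.ireg 1 = σ.ireg 1
  rreg1 : τ.rreg 1 = σ.rreg 1
  rmem : ∀ k < 2 * n, τ.rmem k = σ.rmem k

theorem Preserved.trans {σ₁ σ₂ σ₃ : State} (h : Preserved n σ₁ σ₂) (h' : Preserved n σ₂ σ₃) :
    Preserved n σ₁ σ₃ :=
  ⟨h'.1.trans h.1, h'.2.trans h.2, h'.3.trans h.3, fun k hk => (h'.4 k hk).trans (h.4 k hk)⟩

/-- The invariant of the sweep, when the points of `D` have been processed. -/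
structure SweepInv (n : ℕ) (x y : ℕ → ℝ) (T₀ : ℝ) (σ : State) (D : Finset ℕ) (stack : List ℕ)
    (τ : State) : Prop where
  ctx : Ctx n τ
  points : Points n x y τ
  removed : τ.rreg 4 = -2
  preserved : Preserved n σ τ
  subset : ∀ r ∈ D, r < n
  card : D.card + τ.ireg 5 = n
  inv : Inv x y D (· < σ.ireg 0) T₀ stack (τ.rreg 0)
  stackAt : StackAt (2 * n) τ.imem stack
  len : τ.ireg 6 = stack.length
  len_le : stack.length ≤ D.card
  below : ∀ r < n, r ∉ D → ∀ d ∈ D, y r < y d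
  key : ∀ l < n, τ.key n l = remainingKey y D l
  leaf : ∀ l < n, τ.imem (n + l) = l
  good : ∀ v, 1 ≤ v → v < 2 * n → Good n τ.imem (τ.key n) v

theorem reaches_sweepBody {x y : ℕ → ℝ} {T₀ : ℝ} {τ : State} {D : Finset ℕ} {stack : List ℕ}
    (hm : 3 * n + 5 ≤ m) (hinj : ∀ i < n, ∀ j < n, y i = y j → i = j)
    (h : SweepInv n x y T₀ σ D stack τ) (h5 : 1 ≤ τ.ireg 5) :
    Reaches m (.seq (block loadWinner) (.seq process replay)) τ fun t τ' =>
      ∃ D' stack', SweepInv n x y T₀ σ D' stack' τ' ∧ τ'.ireg 5 + 1 = τ.ireg 5 ∧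
        t + 30 * stack'.length ≤ 30 * stack.length + 12 * (Nat.log 2 n + 1) + 113 := by
  have hk : ∀ k < 20, ∀ c ≥ 20, (k = c) = False := fun k hk c hc => by simp; omega
  have hcard := h.card
  have hlen_le := h.len_le
  have g := h.good 1 le_rfl (by omega)
  obtain ⟨z, hz⟩ : ∃ z, z = τ.imem 1 := ⟨_, rfl⟩
  have hzn : z < n := hz ▸ g.lt
  obtain ⟨hzD, hzlt⟩ := winner_spec (y := y) (D := D) (by omega) hinj hzn fun l hl => by
    rw [← h.key l hl, ← h.key z hzn, hz]
    exact g.le l hl (anc_one (by omega))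
  have hc := h.ctx
  have c1 := h.points.fst z hzn
  have c2 := h.points.snd z hzn
  refine Reaches.block_seq ?_ (Reaches.seq ((reaches_process (x := x) (y := y) (z := z) (D := D)
    (T₀ := T₀) (stack := stack) hm ⟨?_, ?_, ?_, ?_⟩ (h.points.congr ?_ ?_ ?_) ?_ hzn ?_ ?_ ?_ ?_
    (by omega) h.subset (h.below z hzn hzD) ?_).mono ?_))
  · simp [loadWinner, FitsAll, Instr.Fits, Instr.exec, IdxOp.eval, hc.one, hc.two, ← hz]
    omega
  · simp [loadWinner, execs, Instr.exec, hc.two]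
  · simp [loadWinner, execs, Instr.exec, hc.one]
  · simp [loadWinner, execs, Instr.exec, hc.size]
  · simp [loadWinner, execs, Instr.exec, hc.base]
  · simp [loadWinner, execs, Instr.exec]
  · simp [loadWinner, execs, Instr.exec]
  · intro k _
    simp [loadWinner, execs, Instr.exec]
  · simp [loadWinner, execs, Instr.exec, hc.one, hz]
  · simp [loadWinner, execs, Instr.exec, IdxOp.eval, RealOp.eval, hc.one, hc.two, ← hz, c1]
  · simp [loadWinner, execs, Instr.exec, IdxOp.eval, RealOp.eval, hc.one, hc.two, ← hz, c2]
  · simpa [loadWinner, execs, Instr.exec] using h.stackAt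
  · simpa [loadWinner, execs, Instr.exec] using h.len
  · simpa [loadWinner, execs, Instr.exec, h.preserved.ireg0] using h.inv
  · rintro t₁ τ₁ ⟨k1, k2, k3, k4, l, k5, k6, k7, k8, k9⟩
    have s1 : τ₁.rmem = τ.rmem := by simpa [loadWinner, execs, Instr.exec] using k1
    have s2 : ∀ k < 2 * n, τ₁.imem k = τ.imem k := fun k a => by
      simpa [loadWinner, execs, Instr.exec] using k2 k a
    have s3 : ∀ k < 20, k ≠ 5 → k ≠ 6 → k ≠ 7 → k ≠ 9 → τ₁.ireg k = τ.ireg k :=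
      fun k a b c d e => by
        simpa [loadWinner, execs, Instr.exec, b, d, hk k a] using k3 k a c e
    have s4 : ∀ k < 20, k ≠ 0 → k ≠ 5 → k ≠ 6 → τ₁.rreg k = τ.rreg k := fun k a b c d => by
      simpa [loadWinner, execs, Instr.exec, c, d] using k4 k a b
    have s5 : τ₁.ireg 5 + 1 = τ.ireg 5 := by
      rw [k3 5 (by norm_num) (by norm_num) (by norm_num)]
      simp [loadWinner, execs, Instr.exec, IdxOp.eval, hc.one]
      omega
    have s7 : τ₁.ireg 7 = z := by
      rw [k3 7 (by norm_num) (by norm_num) (by norm_num)]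
      simp [loadWinner, execs, Instr.exec, hc.one, hz]
    have e0 : (execs loadWinner τ).ireg 0 = σ.ireg 0 := by
      simp [loadWinner, execs, Instr.exec, h.preserved.ireg0]
    rw [e0] at k5
    have hc₁ : Ctx n τ₁ := hc.congr (by
      intro k hk
      fin_cases hk <;> exact s3 _ (by norm_num) (by norm_num) (by norm_num) (by norm_num)
        (by norm_num))
    have skey : τ₁.key n = τ.key n := by
      funext l
      simp [State.key, s1]
    refine (reaches_replay hm hc₁ s7 hzn ?_ ?_).mono ?_
    · rw [s2 _ (by omega), h.leaf z hzn]
    · intro v h1 h2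
      rw [skey]
      exact (h.good v h1 h2).congr (s2 v h2) fun _ _ _ => rfl
    · rintro t τ' ⟨q1, q2, q3, q4, q5, q6, q7⟩
      refine ⟨insert z D, l, ?_, ?_, ?_⟩
      · refine ⟨?_, ?_, ?_, ?_, ?_, ?_, ?_, ?_, ?_, ?_, ?_, ?_, ?_, q7⟩
        · refine hc₁.congr ?_
          intro k hk
          fin_cases hk <;> exact q2 _ (by norm_num) (by norm_num)
        · refine h.points.congr ?_ ?_ ?_
          · rw [q3 2 (by norm_num), s4 2] <;> norm_num
          · rw [q3 3 (by norm_num), s4 3] <;> norm_num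
          · intro k a
            rw [q5 k a, s1]
        · rw [q3 4 (by norm_num), s4 4, h.removed] <;> norm_num
        · refine h.preserved.trans ⟨?_, ?_, ?_, ?_⟩
          · rw [q2 0 (by norm_num) (by norm_num), s3 0] <;> norm_num
          · rw [q2 1 (by norm_num) (by norm_num), s3 1] <;> norm_num
          · rw [q3 1 (by norm_num), s4 1] <;> norm_num
          · intro k a
            rw [q5 k a, s1]
        · intro r hr
          rcases Finset.mem_insert.1 hr with rfl | hr
          · exact hzn
          · exact h.subset r hr
        · rw [Finset.card_insert_of_notMem hzD, q2 5 (by norm_num) (by norm_num)]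
          omega
        · rw [q3 0 (by norm_num)]
          exact k5
        · exact k6.congr fun k a _ => q4 k (by omega)
        · rw [q2 6 (by norm_num) (by norm_num), k7]
        · rw [Finset.card_insert_of_notMem hzD]
          omega
        · intro r hr hrD d hd
          rcases Finset.mem_insert.1 hd with rfl | hd
          · exact hzlt r hr hrD
          · exact h.below r hr (fun hr' => hrD (Finset.mem_insert_of_mem hr')) d hd
        · intro l hl
          rw [q6, remainingKey, s4 4 (by norm_num) (by norm_num) (by norm_num) (by norm_num),
            h.removed, skey, h.key l hl, remainingKey]
          by_cases hlz : l = z <;> simp [hlz]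
        · intro l hl
          rw [q4 _ (by omega), s2 _ (by omega), h.leaf l hl]
      · rw [q2 5 (by norm_num) (by norm_num), s5]
      · simp [loadWinner]
        omega

/-- The time budget is a fixed amount for each remaining point plus `30` for each stack entry. Both
the initial and the forgotten final credit are harmless, since the stack starts empty. -/
theorem reaches_sweep {x y : ℕ → ℝ} {T₀ : ℝ} {τ : State}
    (hm : 3 * n + 5 ≤ m) (hinj : ∀ i < n, ∀ j < n, y i = y j → i = j)
    (h : SweepInv n x y T₀ σ ∅ [] τ) :
    Reaches m sweep τ fun t τ' => Preserved n σ τ' ∧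
      (∃ stack, Inv x y (Finset.range n) (· < σ.ireg 0) T₀ stack (τ'.rreg 0)) ∧
      t ≤ n * (12 * (Nat.log 2 n + 1) + 114) + 1 := by
  let I : ℕ → State → Prop := fun N τ => ∃ D stack, SweepInv n x y T₀ σ D stack τ ∧
    N = τ.ireg 5 * (12 * (Nat.log 2 n + 1) + 114) + 30 * stack.length + 1
  have h5 : τ.ireg 5 = n := by simpa using h.card
  refine (Reaches.loop (I := I) ?_ _ τ ⟨∅, [], h, rfl⟩).mono ?_
  · rintro N τ ⟨D, stack, hs, rfl⟩
    refine ⟨by omega, fun hb => ?_⟩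
    have hb : 1 ≤ τ.ireg 5 := by simpa [Test.Holds, hs.ctx.one] using hb
    refine (reaches_sweepBody hm hinj hs hb).mono ?_
    rintro t τ' ⟨D', stack', h', e5, ht⟩
    refine ⟨_, ?_, D', stack', h', rfl⟩
    rw [← e5, add_mul]
    omega
  · rintro t τ' ⟨N', hN, ⟨D, stack, hs, -⟩, hb⟩
    have hb : τ'.ireg 5 = 0 := by simpa [Test.Holds, hs.ctx.one] using hb
    refine ⟨hs.preserved, ⟨stack, ?_⟩, ?_⟩
    · have : D = Finset.range n := Finset.eq_of_subset_of_card_le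
        (fun r hr => Finset.mem_range.2 (hs.subset r hr)) (by
          have := hs.card
          simp
          omega)
      rw [← this]
      exact hs.inv
    · rw [h5] at hN
      simp at hN
      omega

/-- The initialization of a sweep in the coordinates that are scaled by `ε` and `δ`. -/
def setup (ε δ : ℚ) : List Instr := [.iop .add 2 0 1, .iconst 3 1, .iconst 4 2, .iop .mul 12 4 2,
  .rconst 2 ε, .rconst 3 δ, .rconst 4 (-2), .iconst 6 0]

/-- A sweep in the coordinates that are scaled by `ε` and `δ`. -/
def pass (ε δ : ℚ) : Prog :=
  .seq (block (setup ε δ)) (.seq fill (.seq build (.seq (block [.imove 5 2]) sweep)))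

theorem reaches_pass {x y : ℕ → ℝ} {ε δ : ℚ} (hm : 3 * n + 5 ≤ m)
    (hn : σ.ireg 0 + σ.ireg 1 = n) (hx : ∀ j < n, ε * σ.rmem (2 * j) = x j)
    (hy : ∀ j < n, δ * σ.rmem (2 * j + 1) = y j)
    (hinj : ∀ i < n, ∀ j < n, y i = y j → i = j) (h0 : -(Real.pi / 2) ≤ σ.rreg 0) :
    Reaches m (pass ε δ) σ fun t τ => Preserved n σ τ ∧
      (∃ stack, Inv x y (Finset.range n) (· < σ.ireg 0) (σ.rreg 0) stack (τ.rreg 0)) ∧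
      t ≤ n * (12 * Nat.log 2 n + 149) + 14 := by
  refine Reaches.block_seq ?_ (Reaches.seq ((reaches_fill (n := n) hm ⟨?_, ?_, ?_, ?_⟩).mono ?_))
  · simp [setup, FitsAll, Instr.Fits, Instr.exec, IdxOp.eval, hn]
    omega
  · simp [setup, execs, Instr.exec]
  · simp [setup, execs, Instr.exec]
  · simp [setup, execs, Instr.exec, IdxOp.eval, hn]
  · simp [setup, execs, Instr.exec, IdxOp.eval, hn]
  · rintro t₁ τ₁ ⟨ht₁, h1, h2, h3, h4⟩
    have hc₁ : Ctx n τ₁ := by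
      constructor
      · rw [h1 4 (by norm_num) (by norm_num)]
        simp [setup, execs, Instr.exec]
      · rw [h1 3 (by norm_num) (by norm_num)]
        simp [setup, execs, Instr.exec]
      · rw [h1 2 (by norm_num) (by norm_num)]
        simp [setup, execs, Instr.exec, IdxOp.eval, hn]
      · rw [h1 12 (by norm_num) (by norm_num)]
        simp [setup, execs, Instr.exec, IdxOp.eval, hn]
    refine Reaches.seq ((reaches_build hm hc₁ ?_).mono ?_)
    · intro v a b
      obtain ⟨j, rfl⟩ := Nat.exists_eq_add_of_le a
      exact good_leaf (by omega) (h4 j (by omega)).2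
    · rintro t₂ τ₂ ⟨ht₂, k1, k2, k3, k4, k5⟩
      have hkey : τ₂.key n = τ₁.key n := by
        funext l
        simp [State.key, k1]
      refine Reaches.block_seq ?_ ((reaches_sweep (σ := σ) (x := x) (y := y) (T₀ := σ.rreg 0) hm
        hinj ?_).mono ?_)
      · simp [FitsAll, Instr.Fits]
      · constructor
        · refine hc₁.congr ?_
          intro k hk
          fin_cases hk <;> simp [execs, Instr.exec, k2]
        · constructor
          · intro j hj
            simp [execs, Instr.exec, k1, k3, h2, h3 (2 * j) (by omega), setup, hx j hj]
          · intro j hj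
            simp [execs, Instr.exec, k1, k3, h2, h3 (2 * j + 1) (by omega), setup, hy j hj]
        · simp [execs, Instr.exec, k3, h2, setup]
        · constructor
          · simp [execs, Instr.exec, k2, h1, setup]
          · simp [execs, Instr.exec, k2, h1, setup]
          · simp [execs, Instr.exec, k3, h2, setup]
          · intro k hk
            simp [execs, Instr.exec, k1, h3 k hk, setup]
        · simp
        · simp [execs, Instr.exec, k2, hc₁.size]
        · simpa [execs, Instr.exec, k3, h2, setup] using Inv.initial h0
        · trivial
        · simp [execs, Instr.exec, k2, h1, setup]
        · simp
        · simp
        · intro l hl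
          have := (h4 l hl).1
          rw [← hkey] at this
          simpa [State.key, remainingKey, execs, Instr.exec, setup, hy l hl] using this
        · intro l hl
          simp [execs, Instr.exec, k4 (n + l) (by omega), (h4 l hl).2]
        · exact k5
      · rintro t₃ τ₃ ⟨q1, q2, q3⟩
        refine ⟨q1, q2, ?_⟩
        simp [setup]
        nlinarith

end RealRAM

/-! ### From four sweeps to the endpoints. -/

namespace RealRAM

open Sweep OBeta

variable {m n : ℕ} {σ : State}

/-- The result of a sweep over all points. -/
theorem inv_eq_min {pt : ℕ → Plane} {k : ℕ} {R B : Set Plane} {ε δ T₀ T V : ℝ}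
    {stack : List ℕ}
    (h : Inv (fun j => ε * (pt j).1) (fun j => δ * (pt j).2) (Finset.range n) (· < k) T₀ stack T)
    (hV : IsMinMax R B ε δ V) (hR : ∀ p, p ∈ R ↔ ∃ j < n, j < k ∧ pt j = p)
    (hB : ∀ p, p ∈ B ↔ ∃ j < n, ¬ j < k ∧ pt j = p) (h₀ : T₀ ≤ Real.pi / 2) : T = min T₀ V := by
  -- Both inequalities confront the lower certificate of one value with the upper certificate of the
  -- other.
  apply le_antisymm
  · refine le_min h.le ?_
    rcases hV.upper with hu | ⟨b, hb, hu⟩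
    · rw [hu]
      exact h.le.trans h₀
    · rcases h.lower with hl | hl
      · rw [hl]
        exact hV.ge
      · obtain ⟨i, hi, hik, rfl⟩ := (hB b).1 hb
        obtain ⟨j, hj, hjk, hlt, hle⟩ := hl i (Finset.mem_range.2 hi) hik
        exact hle.trans (hu (pt j) ((hR _).2 ⟨j, Finset.mem_range.1 hj, hjk, rfl⟩) hlt)
  · rcases h.upper with hu | ⟨i, hi, hik, hu⟩
    · rw [hu]
      exact min_le_left _ _
    · refine (min_le_right _ _).trans ?_
      rcases hV.lower with hl | hl
      · rw [hl]
        exact h.ge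
      · obtain ⟨r, hr, hlt, hle⟩ := hl (pt i) ((hB _).2 ⟨i, Finset.mem_range.1 hi, hik, rfl⟩)
        obtain ⟨j, hj, hjk, rfl⟩ := (hR r).1 hr
        exact hle.trans (hu j (Finset.mem_range.2 hj) hjk hlt)

theorem reaches_pass_min {pt : ℕ → Plane} {R B : Set Plane} {ε δ : ℚ} {V : ℝ}
    (hm : 3 * n + 5 ≤ m) (hn : σ.ireg 0 + σ.ireg 1 = n)
    (hx : ∀ j < n, σ.rmem (2 * j) = (pt j).1) (hy : ∀ j < n, σ.rmem (2 * j + 1) = (pt j).2)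
    (hδ : IsSign δ) (hinj : ∀ i < n, ∀ j < n, (pt i).2 = (pt j).2 → i = j)
    (hR : ∀ p, p ∈ R ↔ ∃ j < n, j < σ.ireg 0 ∧ pt j = p)
    (hB : ∀ p, p ∈ B ↔ ∃ j < n, ¬ j < σ.ireg 0 ∧ pt j = p)
    (hV : IsMinMax R B ε δ V)
    (h0 : -(Real.pi / 2) ≤ σ.rreg 0) (h0' : σ.rreg 0 ≤ Real.pi / 2) :
    Reaches m (pass ε δ) σ fun t τ => Preserved n σ τ ∧ τ.rreg 0 = min (σ.rreg 0) V ∧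
      t ≤ n * (12 * Nat.log 2 n + 149) + 14 := by
  refine (reaches_pass (x := fun j => ε * (pt j).1) (y := fun j => δ * (pt j).2) hm hn
    (fun j hj => by rw [hx j hj]) (fun j hj => by rw [hy j hj]) ?_ h0).mono ?_
  · intro i hi j hj h
    refine hinj i hi j hj ?_
    rcases hδ with hδ | hδ <;> simpa [hδ] using h
  · rintro t τ ⟨h1, ⟨stack, h2⟩, h3⟩
    exact ⟨h1, inv_eq_min h2 hV hR hB h0', h3⟩

/-- Two sweeps from the initial value `π / 2`. -/
def twoPasses (ε δ ε' δ' : ℚ) : Prog :=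
  .seq (block [.rconst 0 0, .rfun .arccos 0 0]) (.seq (pass ε δ) (pass ε' δ'))

/-- A pass lowers the value it finds in register `0`, so running a second one without a reset yields
the minimum of both thresholds. The start value `π / 2 = arccos 0` is neutral, as no threshold
exceeds it. -/
theorem reaches_twoPasses {pt : ℕ → Plane} {R B : Set Plane} {ε δ ε' δ' : ℚ} {V V' : ℝ}
    (hm : 3 * n + 5 ≤ m) (hn : σ.ireg 0 + σ.ireg 1 = n)
    (hx : ∀ j < n, σ.rmem (2 * j) = (pt j).1) (hy : ∀ j < n, σ.rmem (2 * j + 1) = (pt j).2)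
    (hδ : IsSign δ) (hδ' : IsSign δ') (hinj : ∀ i < n, ∀ j < n, (pt i).2 = (pt j).2 → i = j)
    (hR : ∀ p, p ∈ R ↔ ∃ j < n, j < σ.ireg 0 ∧ pt j = p)
    (hB : ∀ p, p ∈ B ↔ ∃ j < n, ¬ j < σ.ireg 0 ∧ pt j = p)
    (hV : IsMinMax R B ε δ V) (hV' : IsMinMax R B ε' δ' V') :
    Reaches m (twoPasses ε δ ε' δ') σ fun t τ => Preserved n σ τ ∧ τ.rreg 0 = min V V' ∧
      t ≤ 2 * (n * (12 * Nat.log 2 n + 149)) + 30 := by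
  have hpi := Real.pi_pos
  refine Reaches.block_seq ?_ (Reaches.seq ((reaches_pass_min (n := n) (pt := pt) (R := R) (B := B)
    (V := V) hm ?_ ?_ ?_ hδ hinj ?_ ?_ hV ?_ ?_).mono ?_))
  · simp [FitsAll, Instr.Fits]
  · simpa [execs, Instr.exec] using hn
  · simpa [execs, Instr.exec] using hx
  · simpa [execs, Instr.exec] using hy
  · simpa [execs, Instr.exec] using hR
  · simpa [execs, Instr.exec] using hB
  · simp [execs, Instr.exec, RealFun.eval]
    linarith
  · simp [execs, Instr.exec, RealFun.eval]
  · rintro t τ ⟨⟨h1, h2, h3, h4⟩, h5, h6⟩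
    simp only [execs, Instr.exec] at h1 h2 h3 h4
    have h5' : τ.rreg 0 = V := by
      rw [h5, min_eq_right]
      simpa [execs, Instr.exec, RealFun.eval] using hV.le
    refine (reaches_pass_min (n := n) (pt := pt) (R := R) (B := B)
      (V := V') hm ?_ ?_ ?_ hδ' hinj ?_ ?_ hV' ?_ ?_).mono ?_
    · rw [h1, h2, hn]
    · intro j hj
      rw [h4 _ (by omega), hx j hj]
    · intro j hj
      rw [h4 _ (by omega), hy j hj]
    · simpa [h1] using hR
    · simpa [h1] using hB
    · rw [h5']
      exact hV.ge
    · rw [h5']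
      exact hV.le
    · rintro t' τ' ⟨k1, k2, k3⟩
      refine ⟨Preserved.trans ⟨h1, h2, ?_, h4⟩ k1, by rw [k2, h5'], ?_⟩
      · simpa using h3
      · simp
        omega

/-- The endpoints of the interval of strict containment. -/
def containmentProg : Prog :=
  .seq (twoPasses 1 1 (-1) (-1)) (.seq (block [.rmove 1 0]) (.seq (twoPasses (-1) 1 1 (-1))
    (.seq (block [.rconst 2 0, .rfun .arccos 2 2, .rop .sub 3 2 1, .rop .add 1 2 0, .rmove 0 3])
      (.cond (.rle 1 0) (block [.iconst 0 0]) (block [.iconst 0 1])))))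

theorem mem_iff_exists_getD {α : Type*} {l : List α} {d p : α} :
    p ∈ l ↔ ∃ j < l.length, l.getD j d = p := by
  rw [List.mem_iff_getElem]
  constructor
  · rintro ⟨j, hj, rfl⟩
    exact ⟨j, hj, List.getD_eq_getElem _ _ hj⟩
  · rintro ⟨j, hj, rfl⟩
    exact ⟨j, hj, (List.getD_eq_getElem _ _ hj).symm⟩

theorem reaches_containmentProg {R B : Finset Plane} (hd : Disjoint R B)
    (hgp : GeneralPosition ((R : Set Plane) ∪ (B : Set Plane))) {rs bs : List Plane}
    (hrs : rs.Nodup) (hR : ∀ p, p ∈ rs ↔ p ∈ R) (hbs : bs.Nodup) (hB : ∀ p, p ∈ bs ↔ p ∈ B)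
    (hn : rs.length + bs.length = n) (hm : 3 * n + 5 ≤ m) :
    Reaches m containmentProg (input rs bs) fun t τ =>
      t ≤ 4 * (n * (12 * Nat.log 2 n + 149)) + 70 ∧
      Describes τ (strictContainmentAngles (R : Set Plane) (B : Set Plane)) := by
  choose T hT using exists_isMinMax R B
  have hS := strictContainmentAngles_eq_Ioo (R := R) (B := B) (T := T) fun ε δ _ _ => hT ε δ
  obtain ⟨pt, hpt⟩ : ∃ pt : ℕ → Plane, pt = fun j => (rs ++ bs).getD j (0, 0) := ⟨_, rfl⟩
  have hlen : (rs ++ bs).length = n := by simp [hn]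
  have hx : ∀ j < n, (input rs bs).rmem (2 * j) = (pt j).1 := fun j _ => by
    simp [input, hpt]
  have hy : ∀ j < n, (input rs bs).rmem (2 * j + 1) = (pt j).2 := fun j _ => by
    have h1 : (2 * j + 1) % 2 = 1 := by omega
    have h2 : (2 * j + 1) / 2 = j := by omega
    simp [input, hpt, h1, h2]
  have hi0 : (input rs bs).ireg 0 = rs.length := by simp [input]
  have hi1 : (input rs bs).ireg 1 = bs.length := by simp [input]
  have hR' : ∀ p, p ∈ (R : Set Plane) ↔ ∃ j < n, j < (input rs bs).ireg 0 ∧ pt j = p := by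
    intro p
    rw [Finset.mem_coe, ← hR, mem_iff_exists_getD (d := ((0, 0) : Plane)), hi0, hpt]
    constructor
    · rintro ⟨j, hj, h⟩
      exact ⟨j, by omega, hj, by rw [← h]; exact List.getD_append _ _ _ _ hj⟩
    · rintro ⟨j, -, hj, h⟩
      exact ⟨j, hj, by rw [← h]; exact (List.getD_append _ _ _ _ hj).symm⟩
  have hB' : ∀ p, p ∈ (B : Set Plane) ↔ ∃ j < n, ¬ j < (input rs bs).ireg 0 ∧ pt j = p := by
    intro p
    rw [Finset.mem_coe, ← hB, mem_iff_exists_getD (d := ((0, 0) : Plane)), hi0, hpt]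
    constructor
    · rintro ⟨j, hj, h⟩
      refine ⟨rs.length + j, by omega, by omega, ?_⟩
      rw [← h]
      exact (List.getD_append_right _ _ _ _ (by omega)).trans (by simp)
    · rintro ⟨j, hj, hj', h⟩
      refine ⟨j - rs.length, by omega, ?_⟩
      rw [← h]
      exact (List.getD_append_right _ _ _ _ (by omega)).symm
  have hnodup : (rs ++ bs).Nodup := List.Nodup.append hrs hbs fun p hp hp' =>
    Finset.disjoint_left.1 hd ((hR p).1 hp) ((hB p).1 hp')
  have hmem : ∀ j < n, pt j ∈ (R : Set Plane) ∪ (B : Set Plane) := by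
    intro j hj
    by_cases h : j < (input rs bs).ireg 0
    · exact .inl ((hR' _).2 ⟨j, hj, h, rfl⟩)
    · exact .inr ((hB' _).2 ⟨j, hj, h, rfl⟩)
  -- Distinct positions hold distinct points, hence distinct heights: the tournament has no ties
  -- among the remaining points.
  have hinj : ∀ i < n, ∀ j < n, (pt i).2 = (pt j).2 → i = j := by
    intro i hi j hj h
    have heq : pt i = pt j := by
      by_contra hne
      exact hgp.2 _ (hmem i hi) _ (hmem j hj) hne h
    simp only [hpt] at heq
    rw [List.getD_eq_getElem _ _ (by omega), List.getD_eq_getElem _ _ (by omega)] at heq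
    exact (hnodup.getElem_inj_iff).1 heq
  have p1 : IsSign ((1 : ℚ) : ℝ) := .inl (by norm_num)
  have p2 : IsSign ((-1 : ℚ) : ℝ) := .inr (by norm_num)
  -- The sign pairs with product `1` determine the left endpoint, those with product `-1` the right
  -- one.
  refine Reaches.seq ((reaches_twoPasses (V := T 1 1) (V' := T (-1) (-1)) hm
    (by rw [hi0, hi1, hn]) hx hy p1 p2 hinj hR' hB' (by simpa using hT 1 1)
    (by simpa using hT (-1) (-1))).mono ?_)
  rintro t₁ τ₁ ⟨⟨a1, a2, a3, a4⟩, a5, a6⟩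
  refine Reaches.block_seq ?_ (Reaches.seq ((reaches_twoPasses (n := n) (pt := pt) (R := R)
    (B := B) (V := T (-1) 1) (V' := T 1 (-1)) hm ?_ ?_ ?_ p1 p2 hinj ?_ ?_ (by simpa using hT (-1) 1)
    (by simpa using hT 1 (-1))).mono ?_))
  · simp [FitsAll, Instr.Fits]
  · simp [execs, Instr.exec, a1, a2, hi0, hi1, hn]
  · intro j hj
    simp only [execs, Instr.exec]
    rw [a4 _ (by omega), hx j hj]
  · intro j hj
    simp only [execs, Instr.exec]
    rw [a4 _ (by omega), hy j hj]
  · simpa only [execs, Instr.exec, a1] using hR'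
  · simpa only [execs, Instr.exec, a1] using hB'
  rintro t₂ τ₂ ⟨⟨b1, b2, b3, b4⟩, b5, b6⟩
  simp [execs, Instr.exec, a5] at b3
  refine Reaches.block_seq ?_ (Reaches.cond (fun hb => Reaches.block ?_ ?_)
    (fun hb => Reaches.block ?_ ?_))
  · simp [FitsAll, Instr.Fits]
  · simp [FitsAll, Instr.Fits]
  · simp [Test.Holds, execs, Instr.exec, RealOp.eval, RealFun.eval, b5, b3] at hb
    refine ⟨by simp; omega, .inl ⟨by simp [execs, Instr.exec], ?_⟩⟩
    rw [hS]
    refine Set.Ioo_eq_empty (not_lt.2 ?_)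
    linarith
  · simp [FitsAll, Instr.Fits]
    omega
  · simp [Test.Holds, execs, Instr.exec, RealOp.eval, RealFun.eval, b5, b3] at hb
    refine ⟨by simp; omega, .inr ⟨by simp [execs, Instr.exec], ?_, ?_⟩⟩
    · simp [execs, Instr.exec, RealOp.eval, RealFun.eval, b5, b3]
      linarith
    · rw [hS]
      simp [execs, Instr.exec, RealOp.eval, RealFun.eval, b5, b3]

/-- For `n ≥ 2` the logarithm is at least `1` and absorbs the linear term. For `n ≤ 1` it vanishes,
and the additive constant has to cover everything. -/
theorem containment_time_le :
    4 * (n * (12 * Nat.log 2 n + 149)) + 70 ≤ 1000 * (n * Nat.log 2 n + 1) := by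
  rcases Nat.lt_or_ge n 2 with h | h
  · interval_cases n <;> simp
  · have hlog : 1 ≤ Nat.log 2 n := Nat.log_pos (by norm_num) h
    have : n * 1 ≤ n * Nat.log 2 n := Nat.mul_le_mul_left _ hlog
    rw [Nat.mul_add, Nat.mul_left_comm n 12]
    omega

end RealRAM

theorem mainTheorem6 :
    (∀ R B : Finset OBeta.Plane, Disjoint R B →
      OBeta.GeneralPosition ((R : Set OBeta.Plane) ∪ (B : Set OBeta.Plane)) →
      ∃ β₁ β₂ : ℝ,
        OBeta.strictContainmentAngles (R : Set OBeta.Plane) (B : Set OBeta.Plane) =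
          Set.Ioo β₁ β₂ ∧
        (OBeta.weakContainmentAngles (R : Set OBeta.Plane) (B : Set OBeta.Plane)).OrdConnected ∧
        interior (OBeta.weakContainmentAngles (R : Set OBeta.Plane) (B : Set OBeta.Plane)) =
          Set.Ioo β₁ β₂) ∧
    (∃ (prog : RealRAM.Prog) (C : ℕ),
      ∀ R B : Finset OBeta.Plane, Disjoint R B →
        OBeta.GeneralPosition ((R : Set OBeta.Plane) ∪ (B : Set OBeta.Plane)) →
        ∀ n : ℕ, n = R.card + B.card →
        ∀ rs bs : List OBeta.Plane,
          rs.Nodup → (∀ p, p ∈ rs ↔ p ∈ R) → bs.Nodup → (∀ p, p ∈ bs ↔ p ∈ B) →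
          ∃ (t : ℕ) (τ : RealRAM.State),
            t ≤ C * (n * Nat.log 2 n + 1) ∧
            RealRAM.Run (C * (n + 1)) prog (RealRAM.input rs bs) t τ ∧
            RealRAM.Describes τ
              (OBeta.strictContainmentAngles (R : Set OBeta.Plane) (B : Set OBeta.Plane))) := by
  refine ⟨fun R B hd hgp => OBeta.containmentAngles_intervals hd hgp,
    RealRAM.containmentProg, 1000, ?_⟩
  intro R B hd hgp n hn rs bs hrs hR hbs hB
  have h1 : rs.length = R.card := by
    rw [← List.toFinset_card_of_nodup hrs]
    congr 1
    ext p
    simp [hR]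
  have h2 : bs.length = B.card := by
    rw [← List.toFinset_card_of_nodup hbs]
    congr 1
    ext p
    simp [hB]
  obtain ⟨t, τ, hrun, ht, hτ⟩ := RealRAM.reaches_containmentProg (n := n) (m := 1000 * (n + 1))
    hd hgp hrs hR hbs hB (by omega) (by omega)
  exact ⟨t, τ, ht.trans RealRAM.containment_time_le, hrun, hτ⟩
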